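/- Let $N,q\in\mathbb{N}_0$ and let $q$-forms on $\mathbb{R}^N$ be complex valued, $E=\sum_I E_I\,dx^I$ with ordered multi-indices $I=(i_1<\dots<i_q)$. Let $L^{2,q}(\mathbb{R}^N)$ be the space of $q$-forms with square integrable components, with scalar product $\langle E,H\rangle_{L^{2,q}}=\int_{\mathbb{R}^N}\sum_I E_I\overline{H_I}\,d\lambda$. Let $\delta$ be the co-derivative, with the sign for which $\langle dE,H\rangle_{L^{2,q+1}}=-\langle E,\delta H\rangle_{L^{2,q}}$ for smooth compactly supported forms (and $\delta=0$ on $0$-forms). Extend $d$ and $\delta$ weakly by this identity: for $E\in L^{2,q}$ and $G\in L^{2,q+1}$, $dE=G$ means $\langle G,\Phi\rangle=-\langle E,\delta\Phi\rangle$ for all smooth compactly supported $(q+1)$-forms $\Phi$; for $q\ge 1$, $H\in L^{2,q}$ and $F\in L^{2,q-1}$, $\delta H=F$ means $\langle F,\Phi\rangle=-\langle H,d\Phi\rangle$ for all smooth compactly supported $(q-1)$-forms $\Phi$. Put $$\mathbf{D}^q(\mathbb{R}^N)=\{E\in L^{2,q}: dE\in L^{2,q+1}\},\quad \mathbf{\Delta}^q(\mathbb{R}^N)=\{H\in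 L^{2,q}:\delta H\in L^{2,q-1}\},$$ $$\mathbf{H}^{1,q}(\mathbb{R}^N)=\{E\in L^{2,q}:\partial_nE\in L^{2,q},\ n=1,\dots,N\},$$ with componentwise weak partial derivatives $\partial_n$. Let $\varepsilon$ be a $C^1$-admissible transformation on $\mathbb{R}^N$: every $\varepsilon(x)$ is a linear map on $q$-forms; with respect to the basis $(dx^I)$ the matrix of $\varepsilon$ has real entries, which are $C^1$ functions on $\mathbb{R}^N$, bounded together with their first derivatives; $\langle\varepsilon E,H\rangle_{L^{2,q}}=\langle E,\varepsilon H\rangle_{L^{2,q}}$ for all $E,H\in L^{2,q}$; and there is $c_0>0$ with $\langle\varepsilon E,E\rangle_{L^{2,q}}\ge c_0\|E\|^2_{L^{2,q}}$ for all $E\in L^{2,q}$. Write $\varepsilon^{-1}\mathbf{\Delta}^q(\mathbb{R}^N)=\{E:\varepsilon E\in\mathbf{\Delta}^q(\mathbb{R}^N)\}$. Then $$\mathbf{D}^q(\mathbb{R}^N)\cap\varepsilon^{-1}\mathbf{\Delta}^q(\mathbb{R}^N)=\mathbf{H}^{1,q}(\mathbb{R}^N)$$ with equivalent norms: there is a constant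 $c>0$, depending only on $N$, $q$ and $\varepsilon$, such that for all $E$ in this space $$c^{-1}\Big(\|E\|^2+\sum_{n=1}^N\|\partial_nE\|^2\Big)^{1/2}\le\big(\|E\|^2+\|dE\|^2+\|\delta\varepsilon E\|^2\big)^{1/2}\le c\,\Big(\|E\|^2+\sum_{n=1}^N\|\partial_nE\|^2\Big)^{1/2},$$ where all norms are the respective $L^2$ norms. -/

import Mathlib

open MeasureTheory
open scoped ContDiff ENNReal ComplexConjugate

noncomputable section

namespace FormRegularity

/-- Euclidean space `ℝ^N`. -/
abbrev Space (N : ℕ) : Type := EuclideanSpace ℝ (Fin N)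

/-- Complex valued alternating `q`-linear forms on `ℝ^N`; a `q`-form on `ℝ^N` is a function
`Space N → Form N q`. -/
abbrev Form (N q : ℕ) : Type := Space N [⋀^Fin q]→L[ℝ] ℂ

/-- The standard unit vectors of `ℝ^N`. -/
def stdVec (N : ℕ) (i : Fin N) : Space N := EuclideanSpace.single i (1 : ℝ)

/-- The component `w_I` of `w = ∑_I w_I dx^I`, for an ordered multi-index
`I = (i_1 < ⋯ < i_q)`, i.e. the value of `w` on `(e_{i_1}, …, e_{i_q})`. -/
def component {N q : ℕ} (w : Form N q) (I : Fin q ↪o Fin N) : ℂ :=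
  w (fun k => stdVec N (I k))

/-- The pointwise scalar product `∗(w ∧ ∗ conj η) = ∑_I w_I conj(η_I)`. -/
def pointInner {N q : ℕ} (w η : Form N q) : ℂ :=
  ∑ I : Fin q ↪o Fin N, component w I * conj (component η I)

/-- The scalar product of `L^{2,q}(ℝ^N)`. -/
def l2Inner {N q : ℕ} (E H : Space N → Form N q) : ℂ :=
  ∫ x, pointInner (E x) (H x)

/-- The squared norm of `L^{2,q}(ℝ^N)`. -/
def l2NormSq {N q : ℕ} (E : Space N → Form N q) : ℝ :=
  ∫ x, ∑ I : Fin q ↪o Fin N, ‖component (E x) I‖ ^ 2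

/-- Square integrable `q`-forms: all the components are in `L²(ℝ^N)`. -/
def IsL2 {N q : ℕ} (E : Space N → Form N q) : Prop :=
  ∀ I : Fin q ↪o Fin N, MemLp (fun x => component (E x) I) 2 volume

/-- Smooth `q`-forms with compact support. -/
def IsTestForm {N q : ℕ} (Φ : Space N → Form N q) : Prop :=
  ContDiff ℝ ∞ Φ ∧ HasCompactSupport Φ

/-- The co-derivative of a differentiable `(q+1)`-form,
`δΦ = ∑_i ι_{e_i} ∂_i Φ`, where `ι` is the interior product. With this sign `δ` is minus the
formal adjoint of `d`, and `dδ + δd` is the componentwise Laplacian. -/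
def coDeriv {N q : ℕ} (Φ : Space N → Form N (q + 1)) (x : Space N) : Form N q :=
  ∑ i : Fin N, (fderiv ℝ Φ x (stdVec N i)).curryLeft (stdVec N i)

/-- `E ∈ L^{2,q}`, `G ∈ L^{2,q+1}` and `dE = G` in the weak sense. -/
def HasWeakExtDeriv {N q : ℕ} (E : Space N → Form N q) (G : Space N → Form N (q + 1)) : Prop :=
  IsL2 E ∧ IsL2 G ∧
    ∀ Φ : Space N → Form N (q + 1), IsTestForm Φ → l2Inner G Φ = -l2Inner E (coDeriv Φ)

/-- `H ∈ L^{2,q}`, `F ∈ L^{2,q-1}` and `δH = F` in the weak sense. There are no forms of degree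
`-1`: the co-derivative of a `0`-form is zero. -/
def HasWeakCoDeriv {N : ℕ} : {q : ℕ} → (Space N → Form N q) → (Space N → Form N (q - 1)) → Prop
  | 0, H, F => IsL2 H ∧ F =ᵐ[volume] 0
  | q + 1, H, F => IsL2 H ∧ IsL2 (q := q) F ∧
      ∀ Φ : Space N → Form N q, IsTestForm Φ →
        l2Inner (q := q) F Φ = -l2Inner H (extDeriv Φ)

/-- `E, P ∈ L^{2,q}` and `∂_i E = P`, componentwise in the weak sense. -/
def HasWeakPartial {N q : ℕ} (i : Fin N) (E P : Space N → Form N q) : Prop :=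
  IsL2 E ∧ IsL2 P ∧
    ∀ I : Fin q ↪o Fin N, ∀ φ : Space N → ℝ, ContDiff ℝ ∞ φ → HasCompactSupport φ →
      ∫ x, φ x • component (P x) I
        = -∫ x, fderiv ℝ φ x (stdVec N i) • component (E x) I

/-- `D^q(ℝ^N)`, as a set of functions (closed under almost everywhere equality). -/
def DSpace (N q : ℕ) : Set (Space N → Form N q) :=
  {E | IsL2 E ∧ ∃ G, HasWeakExtDeriv E G}

/-- `Δ^q(ℝ^N)`, as a set of functions (closed under almost everywhere equality). -/
def DeltaSpace (N q : ℕ) : Set (Space N → Form N q) :=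
  {H | IsL2 H ∧ ∃ F, HasWeakCoDeriv H F}

/-- `H^{1,q}(ℝ^N)`, as a set of functions (closed under almost everywhere equality). -/
def H1Space (N q : ℕ) : Set (Space N → Form N q) :=
  {E | IsL2 E ∧ ∀ i : Fin N, ∃ P, HasWeakPartial i E P}

/-- Transformations: for every `x` a linear map of `q`-forms. -/
abbrev Transformation (N q : ℕ) : Type := Space N → (Form N q →ₗ[ℂ] Form N q)

/-- The form `εE`. -/
def Transformation.app {N q : ℕ} (ε : Transformation N q) (E : Space N → Form N q) :
    Space N → Form N q :=
  fun x => ε x (E x)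

/-- A complex linear map of forms has a real matrix with respect to the basis `dx^I` if and only
if it maps real valued forms to real valued forms. -/
def HasRealCoefficients {N q : ℕ} (T : Form N q →ₗ[ℂ] Form N q) : Prop :=
  ∀ w : Form N q, (∀ v, (w v).im = 0) → ∀ v, (T w v).im = 0

/-- The component function `x ↦ (ε(x)w)_I` for a constant form `w`. For `w = dx^J` this is the
matrix entry `ε_{IJ}`; for general `w` it is the linear combination `∑_J ε_{IJ} w_J` of entries. -/
def coefficient {N q : ℕ} (ε : Transformation N q) (w : Form N q) (I : Fin q ↪o Fin N) :
    Space N → ℂ :=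
  fun x => component (ε x w) I

/-- Admissible transformations: real `L^∞` coefficients, symmetric, uniformly positive definite. -/
structure IsAdmissible {N q : ℕ} (ε : Transformation N q) : Prop where
  bounded : ∀ (w : Form N q) (I : Fin q ↪o Fin N), MemLp (coefficient ε w I) ∞ volume
  real : ∀ᵐ x, HasRealCoefficients (ε x)
  symmetric : ∀ E H : Space N → Form N q, IsL2 E → IsL2 H →
    l2Inner (ε.app E) H = l2Inner E (ε.app H)
  posDef : ∃ c : ℝ, 0 < c ∧ ∀ E : Space N → Form N q, IsL2 E →
    c * l2NormSq E ≤ (l2Inner (ε.app E) E).re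

/-- `C^m`-admissible transformations: admissible with `C^m` coefficients that are bounded together
with all their derivatives up to order `m`. -/
structure IsCmAdmissible {N q : ℕ} (m : ℕ) (ε : Transformation N q) : Prop
    extends IsAdmissible ε where
  contDiff : ∀ (w : Form N q) (I : Fin q ↪o Fin N), ContDiff ℝ m (coefficient ε w I)
  bounded_deriv : ∀ (w : Form N q) (I : Fin q ↪o Fin N), ∀ k ≤ m, ∃ K : ℝ, ∀ x,
    ‖iteratedFDeriv ℝ k (coefficient ε w I) x‖ ≤ K

/-- The norm `(‖E‖² + ‖dE‖² + ‖δεE‖²)^{1/2}` of `D^q ∩ ε^{-1}Δ^q`, where `G = dE` and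
`F = δεE`. -/
def graphNorm {N q : ℕ} (E : Space N → Form N q) (G : Space N → Form N (q + 1))
    (F : Space N → Form N (q - 1)) : ℝ :=
  Real.sqrt (l2NormSq E + l2NormSq G + l2NormSq F)

/-- The norm `(‖E‖² + ∑_i ‖∂_i E‖²)^{1/2}` of `H^{1,q}`, where `P i = ∂_i E`. -/
def h1Norm {N q : ℕ} (E : Space N → Form N q) (P : Fin N → Space N → Form N q) : ℝ :=
  Real.sqrt (l2NormSq E + ∑ i : Fin N, l2NormSq (P i))

end FormRegularity

end

/-! For constant coefficients the inclusion into $H^1$ is Plancherel: on the Fourier side $d$ and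
$\delta$ act by the symbols $2\pi i\,a(\xi)$ and $2\pi i\,b(\xi)$, exterior and interior
multiplication by $\xi$, and $a^*a+b^*b=|\xi|^2$ (`isHodgePair_wedge_co`). For variable
$\varepsilon$ the equation $\delta\varepsilon E=F$ cannot be solved frequency by frequency, so this
identity is combined with difference quotients and the coercivity of $\varepsilon$.

Put $D=E(\cdot+h)-E$ and let $s(\xi)$ be the symbol of this difference. The Hodge identity splits
$\hat D=s\hat E$ into $s|\xi|^{-2}a^*a\hat E$ and $s|\xi|^{-2}b^*b\hat E$ (`rieszPart`). Since
$|s|\le 2\pi|h||\xi|$, the first piece has norm at most $|h|\,\|dE\|$. The second piece is not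
controlled by $\delta E$, which need not exist. But in $\langle D,\varepsilon D\rangle$ it is paired
with $\varepsilon D$, which is the difference of $\varepsilon E$ minus
$(\varepsilon(\cdot+h)-\varepsilon)E(\cdot+h)$. The self-adjoint multiplier $b^*b$ can be moved onto
$\widehat{\varepsilon E}$, where it is bounded by $|h|\,\|\delta\varepsilon E\|$; the commutator is
bounded by $K|h|\,\|E\|$ by the Lipschitz bound. Each contribution carries one factor $\|D\|$, so
coercivity gives $c\|D\|\le|h|(K\|E\|+K\|dE\|+\|\delta\varepsilon E\|)$ (`l2n_diff_le`). Fatou's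
lemma on the Fourier side turns this uniform bound into weak derivatives
(`exists_weakDeriv_of_diff_le`).

Conversely, for $E\in H^1$ the product rule for a $C^1$ field (`HasWeakDiv.product`) gives the weak
derivatives of $\varepsilon E$, and $dE$, $\delta\varepsilon E$ are fixed linear combinations of
first derivatives of $E$ and $\varepsilon E$. Almost everywhere uniqueness of weak derivatives makes
both estimates apply to arbitrary representatives. -/

noncomputable section
-- The Fourier transform on vector valued $L^2$.
namespace FormRegularity
open FourierTransform SchwartzMap Filter Topology

set_option linter.unusedSectionVars false

variable {X : Type*} [NormedAddCommGroup X] [InnerProductSpace ℝ X] [FiniteDimensional ℝ X]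
  [MeasurableSpace X] [BorelSpace X]
  {V : Type*} [NormedAddCommGroup V] [InnerProductSpace ℂ V] [CompleteSpace V]
  {W : Type*} [NormedAddCommGroup W] [InnerProductSpace ℂ W] [CompleteSpace W]

open Classical in
/-- The Fourier transform of a square integrable function (zero for other functions). -/
def l2Fourier (f : X → V) : X → V :=
  if h : MemLp f 2 volume then (𝓕 (h.toLp f) : Lp V 2 (volume : Measure X)) else 0

theorem l2Fourier_of_memLp {f : X → V} (h : MemLp f 2 volume) :
    l2Fourier f = (𝓕 (h.toLp f) : Lp V 2 (volume : Measure X)) := by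
  simp [l2Fourier, h]

theorem memLp_l2Fourier (f : X → V) : MemLp (l2Fourier f) 2 volume := by
  by_cases h : MemLp f 2 volume
  · rw [l2Fourier_of_memLp h]; exact Lp.memLp _
  · simp [l2Fourier, h]

/-- The $L^2$ transform agrees with that of tempered distributions. Through this identity,
statements about `l2Fourier` reduce to Schwartz functions. -/
theorem integral_smul_l2Fourier {f : X → V} (hf : MemLp f 2 volume) (φ : 𝓢(X, ℂ)) :
    ∫ x, φ x • l2Fourier f x = ∫ x, (𝓕 φ) x • f x := by
  have h := congrArg (fun T => T φ) (Lp.fourier_toTemperedDistribution_eq (hf.toLp f))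
  simp only [TemperedDistribution.fourier_apply, Lp.toTemperedDistribution_apply] at h
  rw [l2Fourier_of_memLp hf, ← h]
  apply integral_congr_ae
  filter_upwards [hf.coeFn_toLp] with x hx
  rw [hx]

theorem integral_inner_l2Fourier {f g : X → V} (hf : MemLp f 2 volume) (hg : MemLp g 2 volume) :
    ∫ x, inner ℂ (l2Fourier f x) (l2Fourier g x) = ∫ x, inner ℂ (f x) (g x) := by
  have h := Lp.inner_fourier_eq (hf.toLp f) (hg.toLp g)
  rw [L2.inner_def, L2.inner_def] at h
  rw [l2Fourier_of_memLp hf, l2Fourier_of_memLp hg, h]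
  apply integral_congr_ae
  filter_upwards [hf.coeFn_toLp, hg.coeFn_toLp] with x hx hy
  rw [hx, hy]

theorem eLpNorm_l2Fourier {f : X → V} (hf : MemLp f 2 volume) :
    eLpNorm (l2Fourier f) 2 volume = eLpNorm f 2 volume := by
  have h := Lp.norm_fourier_eq (hf.toLp f)
  rw [Lp.norm_def, Lp.norm_def, ENNReal.toReal_eq_toReal_iff' (Lp.eLpNorm_ne_top _)
    (Lp.eLpNorm_ne_top _)] at h
  rw [l2Fourier_of_memLp hf, h, eLpNorm_congr_ae hf.coeFn_toLp]

theorem exists_l2Fourier_eq {g : X → V} (hg : MemLp g 2 volume) :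
    ∃ f : X → V, MemLp f 2 volume ∧ l2Fourier f =ᵐ[volume] g := by
  refine ⟨(𝓕⁻ (hg.toLp g) : Lp V 2 (volume : Measure X)), Lp.memLp _, ?_⟩
  rw [l2Fourier_of_memLp (Lp.memLp _), Lp.toLp_coeFn, fourier_fourierInv_eq]
  exact hg.coeFn_toLp

theorem l2Fourier_sub {f g : X → V} (hf : MemLp f 2 volume) (hg : MemLp g 2 volume) :
    l2Fourier (fun x => f x - g x) =ᵐ[volume] fun x => l2Fourier f x - l2Fourier g x := by
  have h : (hf.sub hg).toLp = hf.toLp - hg.toLp := MemLp.toLp_sub hf hg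
  have e := l2Fourier_of_memLp (hf.sub hg)
  have e2 : (𝓕 (hf.toLp f - hg.toLp g) : Lp V 2 (volume : Measure X)) = 𝓕 (hf.toLp f) - 𝓕 (hg.toLp g) :=
    (Lp.fourierTransformₗᵢ X V).map_sub _ _
  rw [h, e2] at e
  change l2Fourier (f - g) =ᵐ[volume] _
  rw [e, l2Fourier_of_memLp hf, l2Fourier_of_memLp hg]
  exact Lp.coeFn_sub _ _

/-- A real valued test function as a complex valued Schwartz function. -/
def testSchwartz {φ : X → ℝ} (h₁ : ContDiff ℝ ∞ φ) (h₂ : HasCompactSupport φ) : 𝓢(X, ℂ) :=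
  HasCompactSupport.toSchwartzMap (f := fun x => (φ x : ℂ))
    (h₂.comp_left (g := fun t : ℝ => (t : ℂ)) rfl) (Complex.ofRealCLM.contDiff.comp h₁)

@[simp] theorem testSchwartz_apply {φ : X → ℝ} (h₁ : ContDiff ℝ ∞ φ) (h₂ : HasCompactSupport φ)
    (x : X) : testSchwartz h₁ h₂ x = φ x := rfl

/-- Two `L²` functions with the same pairing with all test functions agree. -/
theorem ae_eq_of_integral_schwartz {f g : X → V} (hf : LocallyIntegrable f) (hg : LocallyIntegrable g)
    (h : ∀ φ : 𝓢(X, ℂ), HasCompactSupport φ → ∫ x, φ x • f x = ∫ x, φ x • g x) : f =ᵐ[volume] g := by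
  refine ae_eq_of_integral_contDiff_smul_eq hf hg fun φ h₁ h₂ => ?_
  simpa using h (testSchwartz h₁ h₂) (h₂.comp_left (g := fun t : ℝ => (t : ℂ)) rfl)

theorem locallyIntegrable_of_memLp_two {f : X → V} (hf : MemLp f 2 volume) : LocallyIntegrable f :=
  hf.locallyIntegrable (by norm_num)

theorem memLp_clm (T : V →L[ℂ] W) {f : X → V} (hf : MemLp f 2 volume) :
    MemLp (fun x => T (f x)) 2 volume := T.comp_memLp' hf

theorem l2Fourier_clm (T : V →L[ℂ] W) {f : X → V} (hf : MemLp f 2 volume) :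
    l2Fourier (fun x => T (f x)) =ᵐ[volume] fun x => T (l2Fourier f x) := by
  have hi : ∀ (ψ : 𝓢(X, ℂ)) {g : X → V}, MemLp g 2 volume → Integrable (fun x => ψ x • g x) :=
    fun ψ g hg => memLp_one_iff_integrable.1 (hg.smul (ψ.memLp 2))
  refine ae_eq_of_integral_schwartz (locallyIntegrable_of_memLp_two (memLp_l2Fourier _))
    (locallyIntegrable_of_memLp_two (memLp_clm T (memLp_l2Fourier _))) fun φ _ => ?_
  rw [integral_smul_l2Fourier (memLp_clm T hf)]
  simp_rw [← T.map_smul]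
  rw [T.integral_comp_comm (hi _ hf), T.integral_comp_comm (hi _ (memLp_l2Fourier _)),
    integral_smul_l2Fourier hf]

theorem l2Fourier_comp_add {f : X → V} (hf : MemLp f 2 volume) (a : X) :
    l2Fourier (fun x => f (x + a)) =ᵐ[volume]
      fun ξ => Complex.exp (2 * Real.pi * (inner ℝ a ξ : ℝ) * Complex.I) • l2Fourier f ξ := by
  have hfa : MemLp (fun x => f (x + a)) 2 volume :=
    hf.comp_measurePreserving (measurePreserving_add_right volume a)
  set e : X → ℂ := fun ξ => Complex.exp (2 * Real.pi * (inner ℝ a ξ : ℝ) * Complex.I) with he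
  have hec : ContDiff ℝ ∞ e := by
    apply ContDiff.cexp
    refine ContDiff.mul (ContDiff.mul contDiff_const ?_) contDiff_const
    exact Complex.ofRealCLM.contDiff.comp (contDiff_const.inner ℝ contDiff_id)
  have hen : ∀ ξ, ‖e ξ‖ = 1 := fun ξ => by
    have : (2 * Real.pi * (inner ℝ a ξ : ℝ) * Complex.I : ℂ)
      = ((2 * Real.pi * (inner ℝ a ξ : ℝ) : ℝ) : ℂ) * Complex.I := by push_cast; ring
    rw [he]; simp only [this]; exact Complex.norm_exp_ofReal_mul_I _
  refine ae_eq_of_integral_schwartz (locallyIntegrable_of_memLp_two (memLp_l2Fourier _)) (locallyIntegrable_of_memLp_two ?_) fun φ hφ => ?_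
  · refine (memLp_l2Fourier f).of_le_mul (c := 1)
      (hec.continuous.aestronglyMeasurable.smul (memLp_l2Fourier f).1) ?_
    exact ae_of_all _ fun x => by rw [norm_smul, hen]
  -- The exponential factor is absorbed into the test function. Compact support of `φ` makes the
  -- product a Schwartz function, and its Fourier transform is that of `φ` translated by `a`;
  -- translation invariance of the integral then finishes.
  · set ψ : 𝓢(X, ℂ) := HasCompactSupport.toSchwartzMap (f := fun x => e x * φ x) (hφ.mul_left)
      (hec.mul (φ.smooth ⊤)) with hψ
    have h1 := integral_smul_l2Fourier hf ψ
    rw [integral_smul_l2Fourier hfa]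
    have h2 : ∀ x, (ψ x) • l2Fourier f x = φ x • e x • l2Fourier f x := fun x => by
      rw [smul_smul, mul_comm]; rfl
    simp_rw [h2] at h1
    rw [h1]
    have h3 : ∀ x, (𝓕 ψ) (x + a) = (𝓕 φ) x := fun x => by
      rw [fourier_coe, fourier_coe, Real.fourier_eq', Real.fourier_eq']
      congr 1
      ext v
      change _ • (e v * φ v) = _
      rw [smul_eq_mul, smul_eq_mul, ← mul_assoc, he, ← Complex.exp_add]
      congr 2
      rw [inner_add_right, real_inner_comm v a]
      push_cast; ring
    have h4 := integral_add_right_eq_self (μ := volume) (fun x => (𝓕 ψ) x • f x) a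
    simp_rw [h3] at h4
    exact h4

end FormRegularity
end

/-! ### Weak divergence equations and their Fourier symbols. -/

noncomputable section
namespace FormRegularity
open FourierTransform SchwartzMap Filter Topology LineDeriv
set_option linter.unusedSectionVars false

variable {X : Type*} [NormedAddCommGroup X] [InnerProductSpace ℝ X] [FiniteDimensional ℝ X]
  [MeasurableSpace X] [BorelSpace X]
  {V : Type*} [NormedAddCommGroup V] [InnerProductSpace ℂ V] [CompleteSpace V]
  {W : Type*} [NormedAddCommGroup W] [InnerProductSpace ℂ W] [CompleteSpace W]
  {ι : Type*} [Fintype ι]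

/-- `∑ i, ∂_{e i} (f i) = g` in the sense of distributions. -/
def HasWeakDiv (e : ι → X) (f : ι → X → V) (g : X → V) : Prop :=
  ∀ φ : X → ℝ, ContDiff ℝ ∞ φ → HasCompactSupport φ →
    ∫ x, φ x • g x = -∑ i, ∫ x, fderiv ℝ φ x (e i) • f i x

theorem integrable_smul_of_memLp {φ : X → ℂ} {g : X → V} (hφ : MemLp φ 2 volume)
    (hg : MemLp g 2 volume) : Integrable (fun x => φ x • g x) :=
  memLp_one_iff_integrable.1 (hg.smul hφ)

theorem integrable_real_smul_of_memLp {φ : X → ℝ} {g : X → V} (hφ : MemLp φ 2 volume)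
    (hg : MemLp g 2 volume) : Integrable (fun x => φ x • g x) :=
  memLp_one_iff_integrable.1 (MemLp.smul (𝕜 := ℝ) hg hφ)

theorem memLp_of_test {Y : Type*} [NormedAddCommGroup Y] {φ : X → Y} (h₁ : Continuous φ)
    (h₂ : HasCompactSupport φ) : MemLp φ 2 volume := h₁.memLp_of_hasCompactSupport h₂

theorem memLp_fderiv_of_test {Y : Type*} [NormedAddCommGroup Y] [NormedSpace ℝ Y] {φ : X → Y}
    (h₁ : ContDiff ℝ 1 φ) (h₂ : HasCompactSupport φ) (v : X) :
    MemLp (fun x => fderiv ℝ φ x v) 2 volume :=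
  memLp_of_test ((h₁.continuous_fderiv one_ne_zero).clm_apply continuous_const) (h₂.fderiv_apply ℝ v)

theorem integral_smul_eq_re_add_im {φ : X → ℂ} {g : X → V} (hφ : MemLp φ 2 volume)
    (hg : MemLp g 2 volume) :
    ∫ x, φ x • g x = (∫ x, (φ x).re • g x) + Complex.I • ∫ x, (φ x).im • g x := by
  rw [← integral_smul, ← integral_add]
  · congr 1; ext x
    conv_lhs => rw [← Complex.re_add_im (φ x)]
    rw [add_smul, mul_comm, mul_smul]; rfl
  · exact integrable_real_smul_of_memLp (Complex.reCLM.comp_memLp' hφ) hg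
  · exact (integrable_real_smul_of_memLp (Complex.imCLM.comp_memLp' hφ) hg).smul _

theorem HasWeakDiv.complex_test {e : ι → X} {f : ι → X → V} {g : X → V} (h : HasWeakDiv e f g)
    (hf : ∀ i, MemLp (f i) 2 volume) (hg : MemLp g 2 volume) {φ : X → ℂ} (h₁ : ContDiff ℝ ∞ φ)
    (h₂ : HasCompactSupport φ) :
    ∫ x, φ x • g x = -∑ i, ∫ x, fderiv ℝ φ x (e i) • f i x := by
  have hd : ∀ x, DifferentiableAt ℝ φ x := fun x => (h₁.differentiable (by simp)) x
  have hre := h (fun x => (φ x).re) (Complex.reCLM.contDiff.comp h₁) (h₂.comp_left (g := Complex.re) rfl)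
  have him := h (fun x => (φ x).im) (Complex.imCLM.contDiff.comp h₁) (h₂.comp_left (g := Complex.im) rfl)
  have dre : ∀ x v, fderiv ℝ (fun x => (φ x).re) x v = (fderiv ℝ φ x v).re := fun x v => by
    have := (Complex.reCLM.hasFDerivAt.comp x (hd x).hasFDerivAt).fderiv
    exact congrArg (fun T => T v) this
  have dim : ∀ x v, fderiv ℝ (fun x => (φ x).im) x v = (fderiv ℝ φ x v).im := fun x v => by
    have := (Complex.imCLM.hasFDerivAt.comp x (hd x).hasFDerivAt).fderiv
    exact congrArg (fun T => T v) this
  simp_rw [dre] at hre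
  simp_rw [dim] at him
  rw [integral_smul_eq_re_add_im (memLp_of_test h₁.continuous h₂) hg, hre, him, smul_neg,
    Finset.smul_sum, ← neg_add, ← Finset.sum_add_distrib]
  congr 1
  refine Finset.sum_congr rfl fun i _ => ?_
  rw [integral_smul_eq_re_add_im (memLp_fderiv_of_test (h₁.of_le (by simp)) h₂ _) (hf i)]

/-- Dilations $\chi(x/(n+1))$ of one bump: the derivatives stay bounded in $n$, and near each point
the functions are eventually constant $1$. This is what dominated convergence needs in passing from
compactly supported to Schwartz test functions. -/
theorem exists_cutoff : ∃ (c : ℕ → X → ℝ) (C : ℝ), (∀ n, ContDiff ℝ ∞ (c n)) ∧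
    (∀ n, HasCompactSupport (c n)) ∧ (∀ n x, ‖c n x‖ ≤ 1) ∧ (∀ n x, ‖fderiv ℝ (c n) x‖ ≤ C) ∧
    ∀ x, ∀ᶠ n in atTop, c n =ᶠ[𝓝 x] fun _ => 1 := by
  let χ : ContDiffBump (0 : X) := ⟨1, 2, one_pos, one_lt_two⟩
  have hsm : ContDiff ℝ ∞ χ := χ.contDiff
  obtain ⟨C, hC⟩ := (χ.hasCompactSupport.fderiv ℝ).exists_bound_of_continuous
    (hsm.continuous_fderiv (by simp))
  have hC0 : 0 ≤ C := (norm_nonneg _).trans (hC 0)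
  have hpos : ∀ n : ℕ, (0 : ℝ) < n + 1 := fun n => by positivity
  refine ⟨fun n x => χ (((n : ℝ) + 1)⁻¹ • x), C, fun n => ?_, fun n => ?_, fun n x => ?_,
    fun n x => ?_, fun x => ?_⟩
  · exact hsm.comp (contDiff_const_smul _)
  · exact χ.hasCompactSupport.comp_smul (inv_ne_zero (hpos n).ne')
  · rw [Real.norm_of_nonneg χ.nonneg]; exact χ.le_one
  · have := ((hsm.differentiable (by simp) (((n : ℝ) + 1)⁻¹ • x)).hasFDerivAt.comp x
      ((hasFDerivAt_id x).const_smul (((n : ℝ) + 1)⁻¹))).fderiv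
    change ‖fderiv ℝ (χ ∘ fun x : X => ((n : ℝ) + 1)⁻¹ • x) x‖ ≤ C
    rw [Function.comp_def] at this ⊢
    rw [this]
    refine (ContinuousLinearMap.opNorm_comp_le _ _).trans ?_
    refine (mul_le_mul (hC _) ?_ (norm_nonneg _) hC0).trans (mul_one C).le
    rw [norm_smul]
    refine mul_le_one₀ ?_ (norm_nonneg _) ContinuousLinearMap.norm_id_le
    rw [Real.norm_of_nonneg (inv_nonneg.2 (hpos n).le)]
    exact inv_le_one_of_one_le₀ (by simp)
  · obtain ⟨n₀, hn₀⟩ := exists_nat_gt ‖x‖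
    filter_upwards [eventually_ge_atTop n₀] with n hn
    have hx : ((n : ℝ) + 1)⁻¹ • x ∈ Metric.ball (0 : X) 1 := by
      rw [mem_ball_zero_iff, norm_smul, Real.norm_of_nonneg (inv_nonneg.2 (hpos n).le),
        inv_mul_lt_iff₀ (hpos n), mul_one]
      have : (n₀ : ℝ) ≤ n := by exact_mod_cast hn
      linarith
    have hcont : ContinuousAt (fun y : X => ((n : ℝ) + 1)⁻¹ • y) x := by fun_prop
    exact hcont.eventually (χ.eventuallyEq_one_of_mem_ball hx)

theorem HasWeakDiv.schwartz {e : ι → X} {f : ι → X → V} {g : X → V} (h : HasWeakDiv e f g)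
    (hf : ∀ i, MemLp (f i) 2 volume) (hg : MemLp g 2 volume) (φ : 𝓢(X, ℂ)) :
    ∫ x, φ x • g x = -∑ i, ∫ x, (∂_{e i} φ) x • f i x := by
  obtain ⟨c, C, hc₁, hc₂, hc₃, hc₄, hc₅⟩ := exists_cutoff (X := X)
  have hφ : ContDiff ℝ ∞ φ := φ.smooth ⊤
  have hφd : ∀ x, DifferentiableAt ℝ φ x := fun x => φ.differentiableAt
  have hψ₁ : ∀ n, ContDiff ℝ ∞ (fun x => c n x • φ x) := fun n => (hc₁ n).smul hφ
  have key := fun n => h.complex_test hf hg (hψ₁ n) ((hc₂ n).smul_right)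
  have d : ∀ n x v, fderiv ℝ (fun x => c n x • φ x) x v
      = c n x • fderiv ℝ φ x v + (fderiv ℝ (c n) x v) • φ x := fun n x v => by
    have := (((hc₁ n).differentiable (by simp) x).hasFDerivAt.smul (hφd x).hasFDerivAt).fderiv
    exact congrArg (fun T => T v) this
  have l1 : Tendsto (fun n => ∫ x, (c n x • φ x) • g x) atTop (𝓝 (∫ x, φ x • g x)) := by
    refine tendsto_integral_of_dominated_convergence (fun x => ‖φ x • g x‖) (fun n => ?_)
      (integrable_smul_of_memLp (φ.memLp 2) hg).norm (fun n => ae_of_all _ fun x => ?_)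
      (ae_of_all _ fun x => ?_)
    · exact ((hψ₁ n).continuous.aestronglyMeasurable).smul hg.1
    · rw [smul_assoc, norm_smul]
      exact mul_le_of_le_one_left (norm_nonneg _) (hc₃ n x)
    · refine tendsto_const_nhds.congr' ?_
      filter_upwards [hc₅ x] with n hn
      rw [hn.eq_of_nhds, one_smul]
  have l2 : ∀ i, Tendsto (fun n => ∫ x, fderiv ℝ (fun x => c n x • φ x) x (e i) • f i x) atTop
      (𝓝 (∫ x, (∂_{e i} φ) x • f i x)) := fun i => by
    -- The Leibniz rule gives two terms. The one where the cutoff is differentiated is dominated by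
    -- `C * ‖e i‖ * ‖φ x • f i x‖` and vanishes eventually at each point.
    refine tendsto_integral_of_dominated_convergence
      (fun x => ‖(∂_{e i} φ) x • f i x‖ + C * ‖e i‖ * ‖φ x • f i x‖) (fun n => ?_)
      (((integrable_smul_of_memLp (φ := ⇑(∂_{e i} φ : 𝓢(X, ℂ))) ((∂_{e i} φ : 𝓢(X, ℂ)).memLp 2) (hf i)).norm).add
        ((integrable_smul_of_memLp (φ.memLp 2) (hf i)).norm.const_mul _))
      (fun n => ae_of_all _ fun x => ?_) (ae_of_all _ fun x => ?_)
    · exact ((((hψ₁ n).continuous_fderiv (by simp)).clm_apply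
        continuous_const).aestronglyMeasurable).smul (hf i).1
    · rw [d, add_smul]
      refine (norm_add_le _ _).trans (add_le_add ?_ ?_)
      · rw [smul_assoc, norm_smul, lineDerivOp_apply_eq_fderiv]
        exact mul_le_of_le_one_left (norm_nonneg _) (hc₃ n x)
      · rw [smul_assoc, norm_smul]
        exact mul_le_mul_of_nonneg_right ((ContinuousLinearMap.le_opNorm _ _).trans
          (mul_le_mul_of_nonneg_right (hc₄ n x) (norm_nonneg _))) (norm_nonneg _)
    · refine tendsto_const_nhds.congr' ?_
      filter_upwards [hc₅ x] with n hn
      have : (fun x => c n x • φ x) =ᶠ[𝓝 x] φ := by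
        filter_upwards [hn] with y hy
        rw [hy, one_smul]
      rw [this.fderiv_eq, lineDerivOp_apply_eq_fderiv]
  refine tendsto_nhds_unique l1 ?_
  simp_rw [key]
  exact (tendsto_finsetSum _ fun i _ => l2 i).neg

theorem memLp_hasTemperateGrowth_smul {s : X → ℂ} (hs : s.HasTemperateGrowth) {f : X → V}
    (hf : MemLp f 2 volume) (φ : 𝓢(X, ℂ)) : Integrable (fun x => φ x • s x • f x) := by
  have := integrable_smul_of_memLp ((SchwartzMap.smulLeftCLM ℂ s φ).memLp 2) hf
  refine this.congr (ae_of_all _ fun x => ?_)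
  simp only
  rw [SchwartzMap.smulLeftCLM_apply_apply hs, smul_smul, smul_eq_mul, mul_comm]

/-- The symbol `2πi ⟨ξ, v⟩` of the derivative in direction `v`. -/
def derivSymbol (v ξ : X) : ℂ := 2 * Real.pi * Complex.I * (inner ℝ ξ v : ℝ)

theorem derivSymbol_hasTemperateGrowth (v : X) :
    (derivSymbol v : X → ℂ).HasTemperateGrowth := by
  unfold derivSymbol
  fun_prop

/-- The symbol is multiplied into the Schwartz function, where it becomes minus a derivative of the
transform. The symbol times `l2Fourier f` need not be in $L^2$. -/
theorem integral_derivSymbol_smul (v : X) {f : X → V} (hf : MemLp f 2 volume) (φ : 𝓢(X, ℂ)) :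
    ∫ ξ, φ ξ • derivSymbol v ξ • l2Fourier f ξ = -∫ x, (∂_{v} (𝓕 φ)) x • f x := by
  have hs : (inner ℝ · v : X → ℝ).HasTemperateGrowth := by fun_prop
  have e1 := integral_smul_l2Fourier hf (SchwartzMap.smulLeftCLM ℂ (derivSymbol v) φ)
  have e2 : 𝓕 (SchwartzMap.smulLeftCLM ℂ (derivSymbol v) φ) = -∂_{v} (𝓕 φ) := by
    rw [SchwartzMap.lineDerivOp_fourier_eq, ← FourierTransform.fourier_neg]
    congr 1
    ext x
    simp [SchwartzMap.smulLeftCLM_apply_apply (derivSymbol_hasTemperateGrowth v),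
      SchwartzMap.smulLeftCLM_apply_apply hs, derivSymbol]
    ring
  rw [e2] at e1
  rw [← integral_neg]
  convert e1 using 2
  · ext x
    rw [SchwartzMap.smulLeftCLM_apply_apply (derivSymbol_hasTemperateGrowth v), smul_smul,
      smul_eq_mul, mul_comm]
  · ext x
    simp

theorem HasWeakDiv.l2Fourier_eq {e : ι → X} {f : ι → X → V} {g : X → V} (h : HasWeakDiv e f g)
    (hf : ∀ i, MemLp (f i) 2 volume) (hg : MemLp g 2 volume) :
    l2Fourier g =ᵐ[volume] fun ξ => ∑ i, derivSymbol (e i) ξ • l2Fourier (f i) ξ := by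
  have hint : ∀ i (φ : 𝓢(X, ℂ)), Integrable (fun x => φ x • derivSymbol (e i) x • l2Fourier (f i) x) :=
    fun i φ => memLp_hasTemperateGrowth_smul (derivSymbol_hasTemperateGrowth _)
      (memLp_l2Fourier _) φ
  refine ae_eq_of_integral_schwartz (locallyIntegrable_of_memLp_two (memLp_l2Fourier _)) ?_ fun φ _ => ?_
  · refine locallyIntegrable_finsetSum _ fun i _ => ?_
    have hl : LocallyIntegrable (l2Fourier (f i)) := locallyIntegrable_of_memLp_two (memLp_l2Fourier _)
    exact hl.continuous_smul (derivSymbol_hasTemperateGrowth (e i)).1.continuous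
  · rw [integral_smul_l2Fourier hg, h.schwartz hf hg]
    simp_rw [Finset.smul_sum]
    rw [integral_finsetSum _ fun i _ => hint i φ, ← Finset.sum_neg_distrib]
    exact Finset.sum_congr rfl fun i _ => (integral_derivSymbol_smul (e i) (hf i) φ).symm

/-- Every test function is the Fourier transform of a Schwartz function `η`; testing the hypothesis
with `η` returns the weak equation. -/
theorem hasWeakDiv_of_l2Fourier_eq {e : ι → X} {f : ι → X → V} {g : X → V}
    (hf : ∀ i, MemLp (f i) 2 volume) (hg : MemLp g 2 volume)
    (h : l2Fourier g =ᵐ[volume] fun ξ => ∑ i, derivSymbol (e i) ξ • l2Fourier (f i) ξ) :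
    HasWeakDiv e f g := by
  intro φ h₁ h₂
  have hint : ∀ i (φ : 𝓢(X, ℂ)), Integrable (fun x => φ x • derivSymbol (e i) x • l2Fourier (f i) x) :=
    fun i φ => memLp_hasTemperateGrowth_smul (derivSymbol_hasTemperateGrowth _)
      (memLp_l2Fourier _) φ
  set ψ := testSchwartz h₁ h₂ with hψ
  set η : 𝓢(X, ℂ) := 𝓕⁻ ψ
  have hη : 𝓕 η = ψ := fourier_fourierInv_eq ψ
  have e1 := integral_smul_l2Fourier hg η
  have e2 : ∫ ξ, η ξ • l2Fourier g ξ
      = ∑ i, ∫ ξ, η ξ • derivSymbol (e i) ξ • l2Fourier (f i) ξ := by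
    rw [← integral_finsetSum _ fun i _ => hint i η]
    refine integral_congr_ae ?_
    filter_upwards [h] with ξ hξ
    rw [hξ, Finset.smul_sum]
  rw [e2] at e1
  simp_rw [integral_derivSymbol_smul (e _) (hf _), hη, Finset.sum_neg_distrib] at e1
  have d : ∀ i x, (∂_{e i} ψ) x = ((fderiv ℝ φ x (e i) : ℝ) : ℂ) := fun i x => by
    rw [lineDerivOp_apply_eq_fderiv]
    have := (Complex.ofRealCLM.hasFDerivAt.comp x
      (h₁.differentiable (by simp) x).hasFDerivAt).fderiv
    exact congrArg (fun T => T (e i)) this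
  simp_rw [d, hψ, testSchwartz_apply, Complex.coe_smul] at e1
  exact e1.symm

end FormRegularity
end

/-! ### First order symbols, Hodge pairs and the estimate of differences. -/

noncomputable section
namespace FormRegularity
open FourierTransform SchwartzMap Filter Topology LineDeriv
set_option linter.unusedSectionVars false

variable {X : Type*} [NormedAddCommGroup X] [InnerProductSpace ℝ X] [FiniteDimensional ℝ X]
  [MeasurableSpace X] [BorelSpace X]
  {V : Type*} [NormedAddCommGroup V] [InnerProductSpace ℂ V] [CompleteSpace V]
  {W : Type*} [NormedAddCommGroup W] [InnerProductSpace ℂ W] [CompleteSpace W]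
  {U : Type*} [NormedAddCommGroup U] [InnerProductSpace ℂ U] [CompleteSpace U]
  {ι : Type*} [Fintype ι]

/-- The `L²` norm of a function. -/
def l2n (f : X → V) : ℝ := (eLpNorm f 2 volume).toReal

theorem l2n_nonneg (f : X → V) : 0 ≤ l2n f := ENNReal.toReal_nonneg

theorem l2n_congr_ae {f g : X → V} (h : f =ᵐ[volume] g) : l2n f = l2n g := by
  rw [l2n, l2n, eLpNorm_congr_ae h]

theorem l2n_eq_norm {f : X → V} (hf : MemLp f 2 volume) : l2n f = ‖hf.toLp f‖ := by
  rw [Lp.norm_toLp, l2n]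

theorem norm_integral_inner_le {f g : X → V} (hf : MemLp f 2 volume) (hg : MemLp g 2 volume) :
    ‖∫ x, inner ℂ (f x) (g x)‖ ≤ l2n f * l2n g := by
  have h := norm_inner_le_norm (𝕜 := ℂ) (hf.toLp f) (hg.toLp g)
  rw [← l2n_eq_norm, ← l2n_eq_norm, L2.inner_def] at h
  have e : ∫ x, inner ℂ (hf.toLp f x) (hg.toLp g x) = ∫ x, inner ℂ (f x) (g x) := by
    apply integral_congr_ae
    filter_upwards [hf.coeFn_toLp, hg.coeFn_toLp] with x hx hy
    rw [hx, hy]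
  rw [← e]
  exact h

theorem integrable_inner_of_memLp {f g : X → V} (hf : MemLp f 2 volume) (hg : MemLp g 2 volume) :
    Integrable (fun x => inner ℂ (f x) (g x)) := by
  refine (L2.integrable_inner (𝕜 := ℂ) (hf.toLp f) (hg.toLp g)).congr ?_
  filter_upwards [hf.coeFn_toLp, hg.coeFn_toLp] with x hx hy
  rw [hx, hy]

theorem integral_inner_self (f : X → V) :
    ∫ x, inner ℂ (f x) (f x) = ((∫ x, ‖f x‖ ^ 2 : ℝ) : ℂ) := by
  rw [← integral_complex_ofReal]
  congr 1; ext x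
  rw [inner_self_eq_norm_sq_to_K]; simp

theorem l2n_sq {f : X → V} (hf : MemLp f 2 volume) : l2n f ^ 2 = ∫ x, ‖f x‖ ^ 2 := by
  have h := inner_self_eq_norm_sq (𝕜 := ℂ) (hf.toLp f)
  rw [← l2n_eq_norm, L2.inner_def] at h
  have h2 : ∫ x, inner ℂ (hf.toLp f x) (hf.toLp f x) = ∫ x, inner ℂ (f x) (f x) := by
    apply integral_congr_ae
    filter_upwards [hf.coeFn_toLp] with x hx
    rw [hx]
  rw [h2, integral_inner_self] at h
  exact h.symm

theorem l2n_le_of_bound {f : X → V} {g : X → W} {C : ℝ} (hf : AEStronglyMeasurable f volume)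
    (hg : MemLp g 2 volume) (hC : 0 ≤ C) (h : ∀ᵐ x, ‖f x‖ ≤ C * ‖g x‖) :
    MemLp f 2 volume ∧ l2n f ≤ C * l2n g := by
  refine ⟨hg.of_le_mul hf h, ?_⟩
  have := eLpNorm_le_mul_eLpNorm_of_ae_le_mul h 2
  have h2 := ENNReal.toReal_mono (ENNReal.mul_ne_top ENNReal.ofReal_ne_top hg.2.ne) this
  rwa [ENNReal.toReal_mul, ENNReal.toReal_ofReal hC] at h2

theorem l2n_l2Fourier {f : X → V} (hf : MemLp f 2 volume) : l2n (l2Fourier f) = l2n f := by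
  rw [l2n, l2n, eLpNorm_l2Fourier hf]

theorem memLp_comp_add {f : X → V} (hf : MemLp f 2 volume) (a : X) :
    MemLp (fun x => f (x + a)) 2 volume :=
  hf.comp_measurePreserving (measurePreserving_add_right volume a)

theorem l2n_comp_add {f : X → V} (hf : MemLp f 2 volume) (a : X) :
    l2n (fun x => f (x + a)) = l2n f := by
  have := eLpNorm_comp_measurePreserving (p := 2) hf.1 (measurePreserving_add_right volume a)
  exact congrArg ENNReal.toReal this

/-- The Fourier symbol of the difference operator `f ↦ f (· + h) - f`. -/
def diffSymbol (h ξ : X) : ℂ := Complex.exp (2 * Real.pi * (inner ℝ h ξ : ℝ) * Complex.I) - 1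

theorem continuous_diffSymbol (h : X) : Continuous (diffSymbol h : X → ℂ) := by
  unfold diffSymbol; fun_prop

theorem norm_diffSymbol_le (h ξ : X) : ‖diffSymbol h ξ‖ ≤ 2 * Real.pi * ‖h‖ * ‖ξ‖ := by
  have e : (2 * Real.pi * (inner ℝ h ξ : ℝ) * Complex.I : ℂ)
      = Complex.I * ((2 * Real.pi * (inner ℝ h ξ : ℝ) : ℝ) : ℂ) := by push_cast; ring
  rw [diffSymbol, e]
  refine (Real.norm_exp_I_mul_ofReal_sub_one_le).trans ?_
  rw [norm_mul, Real.norm_of_nonneg (by positivity : (0 : ℝ) ≤ 2 * Real.pi),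
    mul_assoc (2 * Real.pi) ‖h‖]
  exact mul_le_mul_of_nonneg_left (norm_inner_le_norm (𝕜 := ℝ) h ξ) Real.two_pi_pos.le

theorem l2Fourier_diff {f : X → V} (hf : MemLp f 2 volume) (h : X) :
    l2Fourier (fun x => f (x + h) - f x) =ᵐ[volume] fun ξ => diffSymbol h ξ • l2Fourier f ξ := by
  filter_upwards [l2Fourier_sub (memLp_comp_add hf h) hf, l2Fourier_comp_add hf h] with ξ h1 h2
  rw [h1, h2, diffSymbol, sub_smul, one_smul]

/-- The symbol `∑ i, ⟨ξ, e i⟩ a i` of the first order operator `∑ i, a i ∂_{e i}`. -/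
def opSymbol (e : ι → X) (a : ι → V →L[ℂ] W) (ξ : X) : V →L[ℂ] W :=
  ∑ i, ((inner ℝ ξ (e i) : ℝ) : ℂ) • a i

theorem continuous_opSymbol (e : ι → X) (a : ι → V →L[ℂ] W) : Continuous (opSymbol e a) := by
  unfold opSymbol; fun_prop

theorem HasWeakDiv.l2Fourier_op {e : ι → X} {a : ι → V →L[ℂ] W} {f : X → V} {g : X → W}
    (h : HasWeakDiv e (fun i x => a i (f x)) g) (hf : MemLp f 2 volume) (hg : MemLp g 2 volume) :
    l2Fourier g =ᵐ[volume] fun ξ => (2 * Real.pi * Complex.I : ℂ) • opSymbol e a ξ (l2Fourier f ξ) := by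
  have h1 := h.l2Fourier_eq (fun i => memLp_clm (a i) hf) hg
  have h2 : ∀ᵐ ξ, ∀ i, l2Fourier (fun x => a i (f x)) ξ = a i (l2Fourier f ξ) :=
    ae_all_iff.2 fun i => l2Fourier_clm (a i) hf
  filter_upwards [h1, h2] with ξ h1 h2
  rw [h1, opSymbol, _root_.sum_apply, Finset.smul_sum]
  refine Finset.sum_congr rfl fun i _ => ?_
  rw [h2, derivSymbol, _root_.smul_apply, smul_smul]

/-- The function `diffSymbol h / |ξ|² · (c†c) f̂`, where `c` is the symbol of a first order operator. -/
def rieszPart (e : ι → X) (a : ι → V →L[ℂ] W) (h : X) (f : X → V) (ξ : X) : V :=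
  (diffSymbol h ξ / (‖ξ‖ ^ 2 : ℝ)) •
    ContinuousLinearMap.adjoint (opSymbol e a ξ) (opSymbol e a ξ (l2Fourier f ξ))

theorem aestronglyMeasurable_rieszPart (e : ι → X) (a : ι → V →L[ℂ] W) (h : X) (f : X → V) :
    AEStronglyMeasurable (rieszPart e a h f) volume := by
  have hc := continuous_opSymbol e a
  have hc' : Continuous fun ξ => ContinuousLinearMap.adjoint (opSymbol e a ξ) :=
    ContinuousLinearMap.adjoint.continuous.comp hc
  have h1 : AEStronglyMeasurable (fun ξ => opSymbol e a ξ (l2Fourier f ξ)) volume :=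
    isBoundedBilinearMap_apply.continuous.comp_aestronglyMeasurable
      (hc.aestronglyMeasurable.prodMk (memLp_l2Fourier f).1)
  have h2 : AEStronglyMeasurable (fun ξ => ContinuousLinearMap.adjoint (opSymbol e a ξ)
      (opSymbol e a ξ (l2Fourier f ξ))) volume :=
    isBoundedBilinearMap_apply.continuous.comp_aestronglyMeasurable
      (hc'.aestronglyMeasurable.prodMk h1)
  refine AEStronglyMeasurable.smul ?_ h2
  refine Measurable.aestronglyMeasurable ?_
  exact (continuous_diffSymbol h).measurable.div
    (Complex.continuous_ofReal.comp (continuous_norm.pow 2)).measurable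

/-- One factor $|\xi|$ from the difference symbol and one from the adjoint symbol cancel
$|\xi|^{-2}$. What remains is the symbol applied to $\hat f$, that is $\hat g$ up to $2\pi i$, and
the $2\pi$ cancels too. -/
theorem rieszPart_bound_source {e : ι → X} {a : ι → V →L[ℂ] W}
    (ha : ∀ ξ, ‖opSymbol e a ξ‖ ≤ ‖ξ‖) (h : X) {f : X → V} {g : X → W}
    (hf : MemLp f 2 volume) (hg : MemLp g 2 volume)
    (hfg : HasWeakDiv e (fun i x => a i (f x)) g) :
    MemLp (rieszPart e a h f) 2 volume ∧ l2n (rieszPart e a h f) ≤ ‖h‖ * l2n g := by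
  rw [← l2n_l2Fourier hg]
  refine l2n_le_of_bound (aestronglyMeasurable_rieszPart e a h f) (memLp_l2Fourier g)
    (norm_nonneg h) ?_
  filter_upwards [hfg.l2Fourier_op hf hg] with ξ hξ
  set y := opSymbol e a ξ (l2Fourier f ξ)
  have hy : ‖l2Fourier g ξ‖ = 2 * Real.pi * ‖y‖ := by
    rw [hξ, norm_smul]; simp [abs_of_pos Real.pi_pos]
  rw [hy, rieszPart, norm_smul, norm_div, Complex.norm_real, norm_pow, norm_norm]
  rcases eq_or_ne ξ 0 with rfl | h0
  · simp; positivity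
  have hp : 0 < ‖ξ‖ := norm_pos_iff.2 h0
  have h1 : ‖ContinuousLinearMap.adjoint (opSymbol e a ξ) y‖ ≤ ‖ξ‖ * ‖y‖ := by
    refine (ContinuousLinearMap.le_opNorm _ _).trans ?_
    rw [LinearIsometryEquiv.norm_map]
    exact mul_le_mul_of_nonneg_right (ha ξ) (norm_nonneg _)
  calc _ ≤ (2 * Real.pi * ‖h‖ * ‖ξ‖) / ‖ξ‖ ^ 2 * (‖ξ‖ * ‖y‖) := by
        gcongr; exact norm_diffSymbol_le h ξ
    _ = _ := by field_simp

/-- No equation for `f` is needed here: $c^*c$ has norm at most $|\xi|^2$, so the multiplier only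
shrinks the transform of the difference. -/
theorem rieszPart_bound_diff {e : ι → X} {a : ι → V →L[ℂ] W}
    (ha : ∀ ξ, ‖opSymbol e a ξ‖ ≤ ‖ξ‖) (h : X) {f : X → V} (hf : MemLp f 2 volume) :
    MemLp (rieszPart e a h f) 2 volume ∧
      l2n (rieszPart e a h f) ≤ l2n (fun x => f (x + h) - f x) := by
  have hd : MemLp (fun x => f (x + h) - f x) 2 volume := (memLp_comp_add hf h).sub hf
  rw [← l2n_l2Fourier hd, ← one_mul (l2n (l2Fourier _))]
  refine l2n_le_of_bound (aestronglyMeasurable_rieszPart e a h f) (memLp_l2Fourier _)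
    zero_le_one ?_
  filter_upwards [l2Fourier_diff hf h] with ξ hξ
  rw [hξ, rieszPart, norm_smul, norm_div, Complex.norm_real, norm_pow, norm_norm, one_mul, norm_smul]
  rcases eq_or_ne ξ 0 with rfl | h0
  · simp; positivity
  have hp : 0 < ‖ξ‖ := norm_pos_iff.2 h0
  have h1 : ‖ContinuousLinearMap.adjoint (opSymbol e a ξ) (opSymbol e a ξ (l2Fourier f ξ))‖
      ≤ ‖ξ‖ * (‖ξ‖ * ‖l2Fourier f ξ‖) := by
    refine (ContinuousLinearMap.le_opNorm _ _).trans ?_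
    rw [LinearIsometryEquiv.norm_map]
    refine mul_le_mul (ha ξ) ?_ (norm_nonneg _) (norm_nonneg _)
    exact (ContinuousLinearMap.le_opNorm _ _).trans
      (mul_le_mul_of_nonneg_right (ha ξ) (norm_nonneg _))
  calc _ ≤ ‖diffSymbol h ξ‖ / ‖ξ‖ ^ 2 * (‖ξ‖ * (‖ξ‖ * ‖l2Fourier f ξ‖)) := by gcongr
    _ = _ := by field_simp

/-- `A = ∑ i, a i ∂_{e i}` and `B = ∑ i, b i ∂_{e i}` satisfy `A*A + B*B = -Δ`. -/
def IsHodgePair (e : ι → X) (a : ι → V →L[ℂ] W) (b : ι → V →L[ℂ] U) : Prop :=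
  ∀ ξ w, ContinuousLinearMap.adjoint (opSymbol e a ξ) (opSymbol e a ξ w)
    + ContinuousLinearMap.adjoint (opSymbol e b ξ) (opSymbol e b ξ w) = ((‖ξ‖ ^ 2 : ℝ) : ℂ) • w

theorem IsHodgePair.norm_sq {e : ι → X} {a : ι → V →L[ℂ] W} {b : ι → V →L[ℂ] U}
    (h : IsHodgePair e a b) (ξ : X) (w : V) :
    ‖opSymbol e a ξ w‖ ^ 2 + ‖opSymbol e b ξ w‖ ^ 2 = (‖ξ‖ * ‖w‖) ^ 2 := by
  have h1 := congrArg (fun y => RCLike.re (inner ℂ y w)) (h ξ w)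
  simp only [inner_add_left, ContinuousLinearMap.adjoint_inner_left, inner_smul_left,
    Complex.conj_ofReal, map_add, inner_self_eq_norm_sq] at h1
  rw [h1, mul_pow, ← inner_self_eq_norm_sq (𝕜 := ℂ) w]
  exact Complex.re_ofReal_mul _ _

theorem IsHodgePair.left_le {e : ι → X} {a : ι → V →L[ℂ] W} {b : ι → V →L[ℂ] U}
    (h : IsHodgePair e a b) (ξ : X) : ‖opSymbol e a ξ‖ ≤ ‖ξ‖ :=
  ContinuousLinearMap.opNorm_le_bound _ (norm_nonneg _) fun w =>
    abs_le_of_sq_le_sq' (by nlinarith [h.norm_sq ξ w, sq_nonneg ‖opSymbol e b ξ w‖])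
      (by positivity) |>.2

theorem IsHodgePair.right_le {e : ι → X} {a : ι → V →L[ℂ] W} {b : ι → V →L[ℂ] U}
    (h : IsHodgePair e a b) (ξ : X) : ‖opSymbol e b ξ‖ ≤ ‖ξ‖ :=
  ContinuousLinearMap.opNorm_le_bound _ (norm_nonneg _) fun w =>
    abs_le_of_sq_le_sq' (by nlinarith [h.norm_sq ξ w, sq_nonneg ‖opSymbol e a ξ w‖])
      (by positivity) |>.2

theorem IsHodgePair.rieszPart_add {e : ι → X} {a : ι → V →L[ℂ] W} {b : ι → V →L[ℂ] U}
    (hab : IsHodgePair e a b) (h : X) (f : X → V) (ξ : X) :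
    rieszPart e a h f ξ + rieszPart e b h f ξ = diffSymbol h ξ • l2Fourier f ξ := by
  rw [rieszPart, rieszPart, ← smul_add, hab ξ, smul_smul]
  -- At $\xi=0$ the division in `rieszPart` yields $0$, which is correct because `diffSymbol h 0 =
  -- 0`.
  rcases eq_or_ne ξ 0 with rfl | h0
  · simp [diffSymbol]
  · have : ((‖ξ‖ ^ 2 : ℝ) : ℂ) ≠ 0 := by
      have := norm_ne_zero_iff.2 h0
      exact_mod_cast pow_ne_zero 2 this
    rw [div_mul_cancel₀ _ this]

/-- A bounded, Lipschitz continuous, uniformly positive field of linear maps. -/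
structure IsLipschitzCoeff (M : X → V →L[ℂ] V) (c K : ℝ) : Prop where
  cont : Continuous M
  pos : 0 < c
  nonneg : 0 ≤ K
  bound : ∀ x, ‖M x‖ ≤ K
  lipschitz : ∀ x y, ‖M x - M y‖ ≤ K * ‖x - y‖
  coercive : ∀ f : X → V, MemLp f 2 volume → c * l2n f ^ 2 ≤ (∫ x, inner ℂ (f x) (M x (f x))).re

theorem l2n_coeff_apply {M : X → V →L[ℂ] V} {K : ℝ} (hc : Continuous M) (hK : 0 ≤ K)
    (hM : ∀ x, ‖M x‖ ≤ K) {f : X → V} (hf : MemLp f 2 volume) :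
    MemLp (fun x => M x (f x)) 2 volume ∧ l2n (fun x => M x (f x)) ≤ K * l2n f := by
  refine l2n_le_of_bound ?_ hf hK (ae_of_all _ fun x => ?_)
  · exact isBoundedBilinearMap_apply.continuous.comp_aestronglyMeasurable
      (hc.aestronglyMeasurable.prodMk hf.1)
  · exact (ContinuousLinearMap.le_opNorm _ _).trans
      (mul_le_mul_of_nonneg_right (hM x) (norm_nonneg _))

/-- The main estimate for the difference quotients. -/
theorem l2n_diff_le {e : ι → X} {a : ι → V →L[ℂ] W} {b : ι → V →L[ℂ] U}
    (hab : IsHodgePair e a b) {M : X → V →L[ℂ] V} {c K : ℝ} (hM : IsLipschitzCoeff M c K)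
    {E : X → V} {G : X → W} {F : X → U} (hE : MemLp E 2 volume) (hG : MemLp G 2 volume)
    (hF : MemLp F 2 volume) (hEG : HasWeakDiv e (fun i x => a i (E x)) G)
    (hEF : HasWeakDiv e (fun i x => b i (M x (E x))) F) (h : X) :
    c * l2n (fun x => E (x + h) - E x) ≤ ‖h‖ * (K * l2n E + K * l2n G + l2n F) := by
  set D : X → V := fun x => E (x + h) - E x with hDdef
  have hD : MemLp D 2 volume := (memLp_comp_add hE h).sub hE
  set m : X → V := fun x => M x (E x) with hmdef
  have hm : MemLp m 2 volume := (l2n_coeff_apply hM.cont hM.nonneg hM.bound hE).1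
  set T : X → V := fun x => M x (D x) with hTdef
  obtain ⟨hT, hTn⟩ := l2n_coeff_apply hM.cont hM.nonneg hM.bound hD
  set R : X → V := fun x => (M (x + h) - M x) (E (x + h)) with hRdef
  obtain ⟨hR, hRn⟩ := l2n_coeff_apply (M := fun x => M (x + h) - M x) (K := K * ‖h‖)
    ((hM.cont.comp (continuous_id.add continuous_const)).sub hM.cont)
    (mul_nonneg hM.nonneg (norm_nonneg _)) (fun x => by simpa using hM.lipschitz (x + h) x)
    (memLp_comp_add hE h)
  rw [l2n_comp_add hE] at hRn
  have hΔm : MemLp (fun x => m (x + h) - m x) 2 volume := (memLp_comp_add hm h).sub hm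
  -- Discrete product rule: `R` is the commutator of the difference operator with `M`.
  have hTeq : T = fun x => (m (x + h) - m x) - R x := by
    ext x; simp [hTdef, hmdef, hRdef, hDdef]
  have hThat : l2Fourier T =ᵐ[volume] fun ξ => diffSymbol h ξ • l2Fourier m ξ - l2Fourier R ξ := by
    rw [hTeq]
    filter_upwards [l2Fourier_sub hΔm hR, l2Fourier_diff hm h] with ξ h1 h2
    rw [h1, h2]
  obtain ⟨hva, hvan⟩ := rieszPart_bound_source hab.left_le h hE hG hEG
  obtain ⟨hub, hubn⟩ := rieszPart_bound_diff hab.right_le h hE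
  obtain ⟨hz, hzn⟩ := rieszPart_bound_source hab.right_le h hm hF hEF
  -- Only the left argument is split by the Hodge identity. The `a`-part stays paired with all of
  -- `T`; the `b`-part is paired with the two terms of `T` separately.
  have key : ∫ x, inner ℂ (D x) (T x)
      = (∫ ξ, inner ℂ (rieszPart e a h E ξ) (l2Fourier T ξ))
        + ((∫ ξ, inner ℂ (l2Fourier D ξ) (rieszPart e b h m ξ))
        - ∫ ξ, inner ℂ (rieszPart e b h E ξ) (l2Fourier R ξ)) := by
    have i1 := integrable_inner_of_memLp hva (memLp_l2Fourier T)
    have i2 := integrable_inner_of_memLp (memLp_l2Fourier D) hz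
    have i3 := integrable_inner_of_memLp hub (memLp_l2Fourier R)
    have i4 : Integrable (fun ξ => inner ℂ (l2Fourier D ξ) (rieszPart e b h m ξ)
      - inner ℂ (rieszPart e b h E ξ) (l2Fourier R ξ)) := i2.sub i3
    rw [← integral_inner_l2Fourier hD hT, ← integral_sub i2 i3, ← integral_add i1 i4]
    refine integral_congr_ae ?_
    filter_upwards [l2Fourier_diff hE h, hThat] with ξ h1 h2
    -- The multiplier $|\xi|^{-2}b^*b$ is self-adjoint, so it moves from $\hat E$ to $\hat m$, the
    -- only one of the two for which the `b`-equation is known.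
    have h3 : inner ℂ (rieszPart e b h E ξ) (diffSymbol h ξ • l2Fourier m ξ)
        = inner ℂ (diffSymbol h ξ • l2Fourier E ξ) (rieszPart e b h m ξ) := by
      simp only [rieszPart, map_smul, inner_smul_left, inner_smul_right,
        ContinuousLinearMap.adjoint_inner_left, ContinuousLinearMap.adjoint_inner_right,
        map_div₀, Complex.conj_ofReal]
      ring
    rw [h1, ← h3, ← hab.rieszPart_add, inner_add_left, add_right_inj]
    conv_lhs => rw [h2]
    rw [inner_sub_right]
  have hre := hM.coercive D hD
  change _ ≤ (∫ x, inner ℂ (D x) (T x)).re at hre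
  have hle : c * l2n D ^ 2 ≤ l2n D * (‖h‖ * (K * l2n E + K * l2n G + l2n F)) := by
    refine hre.trans ((Complex.re_le_norm _).trans ?_)
    rw [key]
    have b1 := norm_integral_inner_le hva (memLp_l2Fourier T)
    have b2 := norm_integral_inner_le (memLp_l2Fourier D) hz
    have b3 := norm_integral_inner_le hub (memLp_l2Fourier R)
    rw [l2n_l2Fourier hT] at b1
    rw [l2n_l2Fourier hD] at b2
    rw [l2n_l2Fourier hR] at b3
    refine (norm_add_le _ _).trans ((add_le_add_right (norm_sub_le _ _) _).trans ?_)
    have c1 := b1.trans (mul_le_mul hvan hTn (l2n_nonneg _)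
      (mul_nonneg (norm_nonneg h) (l2n_nonneg _)))
    have c2 := b2.trans (mul_le_mul_of_nonneg_left hzn (l2n_nonneg _))
    have c3 := b3.trans (mul_le_mul hubn hRn (l2n_nonneg _) (l2n_nonneg _))
    calc _ ≤ _ := add_le_add c1 (add_le_add c2 c3)
      _ = _ := by ring
  -- The factor `l2n D` can be cancelled only if it is nonzero; otherwise the claim is trivial.
  rcases (l2n_nonneg D).eq_or_lt with h0 | h0
  · rw [← h0, mul_zero]
    exact mul_nonneg (norm_nonneg _) (add_nonneg (add_nonneg (mul_nonneg hM.nonneg (l2n_nonneg _))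
      (mul_nonneg hM.nonneg (l2n_nonneg _))) (l2n_nonneg _))
  · have : l2n D * (c * l2n D) ≤ l2n D * (‖h‖ * (K * l2n E + K * l2n G + l2n F)) := by
      nlinarith
    exact le_of_mul_le_mul_left this h0

/-! ### From difference quotients to weak derivatives. -/

theorem tendsto_diffSymbol (v ξ : X) :
    Tendsto (fun n : ℕ => ((n : ℂ) + 1) * diffSymbol (((n : ℝ) + 1)⁻¹ • v) ξ) atTop
      (𝓝 (derivSymbol v ξ)) := by
  set z : ℂ := derivSymbol v ξ with hz
  have hd : HasDerivAt (fun t : ℂ => Complex.exp (t * z)) z 0 := by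
    have := ((hasDerivAt_id (0 : ℂ)).mul_const z).cexp
    simpa using this
  have ht : Tendsto (fun n : ℕ => ((n : ℂ) + 1)⁻¹) atTop (𝓝[≠] 0) := by
    refine tendsto_nhdsWithin_iff.2 ⟨?_, Eventually.of_forall fun n => ?_⟩
    · have := tendsto_one_div_add_atTop_nhds_zero_nat (𝕜 := ℝ)
      have h2 := (Complex.continuous_ofReal.tendsto 0).comp this
      simpa [Function.comp_def] using h2
    · exact inv_ne_zero (Nat.cast_add_one_ne_zero n)
  -- The scaled symbol is the slope of $t\mapsto e^{tz}$ between $0$ and $1/(n+1)$.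
  have := (hasDerivAt_iff_tendsto_slope.1 hd).comp ht
  refine this.congr fun n => ?_
  simp only [Function.comp, slope, vsub_eq_sub, sub_zero, zero_mul, Complex.exp_zero, inv_inv,
    smul_eq_mul, diffSymbol]
  congr 3
  rw [hz, derivSymbol, inner_smul_left, real_inner_comm]
  push_cast
  simp
  ring

theorem hasWeakDiv_single {v : X} {f g : X → V} (hf : MemLp f 2 volume) (hg : MemLp g 2 volume) :
    HasWeakDiv (fun _ : Unit => v) (fun _ => f) g ↔
      l2Fourier g =ᵐ[volume] fun ξ => derivSymbol v ξ • l2Fourier f ξ := by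
  constructor
  · intro h
    simpa using h.l2Fourier_eq (fun _ => hf) hg
  · intro h
    exact hasWeakDiv_of_l2Fourier_eq (fun _ => hf) hg (by simpa using h)

/-- Bounded difference quotients give a weak derivative. -/
theorem exists_weakDeriv_of_diff_le {f : X → V} (hf : MemLp f 2 volume) {v : X} {C : ℝ}
    (h : ∀ n : ℕ, (n + 1 : ℝ) * l2n (fun x => f (x + ((n : ℝ) + 1)⁻¹ • v) - f x) ≤ C) :
    ∃ g : X → V, MemLp g 2 volume ∧ HasWeakDiv (fun _ : Unit => v) (fun _ => f) g ∧ l2n g ≤ C := by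
  have hC : 0 ≤ C := le_trans (mul_nonneg (by positivity) (l2n_nonneg _)) (h 0)
  set d : ℕ → X → V := fun n ξ =>
    (((n : ℂ) + 1) * diffSymbol (((n : ℝ) + 1)⁻¹ • v) ξ) • l2Fourier f ξ with hd
  have hdm : ∀ n, AEStronglyMeasurable (d n) volume := fun n =>
    ((continuous_const.mul (continuous_diffSymbol _)).aestronglyMeasurable).smul
      (memLp_l2Fourier f).1
  have hdn : ∀ n, eLpNorm (d n) 2 volume ≤ ENNReal.ofReal C := fun n => by
    have hD : MemLp (fun x => f (x + ((n : ℝ) + 1)⁻¹ • v) - f x) 2 volume :=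
      (memLp_comp_add hf _).sub hf
    have hb : ∀ᵐ ξ, ‖d n ξ‖ ≤ (n + 1 : ℝ)
        * ‖l2Fourier (fun x => f (x + ((n : ℝ) + 1)⁻¹ • v) - f x) ξ‖ := by
      filter_upwards [l2Fourier_diff hf (((n : ℝ) + 1)⁻¹ • v)] with ξ hξ
      rw [hξ, hd]
      simp only [mul_smul]
      rw [norm_smul]
      refine le_of_eq ?_
      congr 1
      exact_mod_cast Complex.norm_natCast (n + 1)
    obtain ⟨h1, h2⟩ := l2n_le_of_bound (hdm n) (memLp_l2Fourier _) (by positivity) hb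
    rw [l2n_l2Fourier hD] at h2
    exact (ENNReal.le_ofReal_iff_toReal_le h1.2.ne hC).2 (h2.trans (h n))
  set p : X → V := fun ξ => derivSymbol v ξ • l2Fourier f ξ with hp
  have hpm : AEStronglyMeasurable p volume :=
    ((derivSymbol_hasTemperateGrowth v).1.continuous.aestronglyMeasurable).smul
      (memLp_l2Fourier f).1
  -- Fatou's lemma: the transformed difference quotients converge pointwise, so the limit inherits
  -- the bound without extraction of a weakly convergent subsequence. By surjectivity of the $L^2$
  -- transform the limit is $\hat g$ for some `g`.
  have hpn : eLpNorm p 2 volume ≤ ENNReal.ofReal C := by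
    refine (Lp.eLpNorm_lim_le_liminf_eLpNorm hdm p (ae_of_all _ fun ξ =>
      (tendsto_diffSymbol v ξ).smul_const _)).trans ?_
    exact (liminf_le_liminf (Eventually.of_forall hdn)).trans (by simp)
  have hpL : MemLp p 2 volume := ⟨hpm, hpn.trans_lt ENNReal.ofReal_lt_top⟩
  obtain ⟨g, hg, hgp⟩ := exists_l2Fourier_eq hpL
  refine ⟨g, hg, (hasWeakDiv_single hf hg).2 hgp, ?_⟩
  rw [← l2n_l2Fourier hg, l2n_congr_ae hgp]
  exact ENNReal.toReal_le_of_le_ofReal hC hpn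

theorem exists_weakDeriv_of_hodge {e : ι → X} {a : ι → V →L[ℂ] W} {b : ι → V →L[ℂ] U}
    (hab : IsHodgePair e a b) {M : X → V →L[ℂ] V} {c K : ℝ} (hM : IsLipschitzCoeff M c K)
    {E : X → V} {G : X → W} {F : X → U} (hE : MemLp E 2 volume) (hG : MemLp G 2 volume)
    (hF : MemLp F 2 volume) (hEG : HasWeakDiv e (fun i x => a i (E x)) G)
    (hEF : HasWeakDiv e (fun i x => b i (M x (E x))) F) (v : X) :
    ∃ P : X → V, MemLp P 2 volume ∧ HasWeakDiv (fun _ : Unit => v) (fun _ => E) P ∧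
      l2n P ≤ c⁻¹ * ‖v‖ * (K * l2n E + K * l2n G + l2n F) := by
  refine exists_weakDeriv_of_diff_le hE fun n => ?_
  have h := l2n_diff_le hab hM hE hG hF hEG hEF (((n : ℝ) + 1)⁻¹ • v)
  have hn : (0 : ℝ) < n + 1 := by positivity
  rw [norm_smul, Real.norm_of_nonneg (inv_nonneg.2 hn.le)] at h
  have hc := hM.pos
  rw [← mul_le_mul_iff_right₀ hc]
  calc _ = ((n : ℝ) + 1) * (c * l2n (fun x => E (x + ((n : ℝ) + 1)⁻¹ • v) - E x)) := by ring
    _ ≤ ((n : ℝ) + 1) * (((n : ℝ) + 1)⁻¹ * ‖v‖ * (K * l2n E + K * l2n G + l2n F)) := by gcongr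
    _ = _ := by field_simp

end FormRegularity
end

/-! ### Vector valued test functions and the product rule. -/

noncomputable section
namespace FormRegularity
open FourierTransform SchwartzMap Filter Topology LineDeriv
set_option linter.unusedSectionVars false

variable {X : Type*} [NormedAddCommGroup X] [InnerProductSpace ℝ X] [FiniteDimensional ℝ X]
  [MeasurableSpace X] [BorelSpace X]
  {V : Type*} [NormedAddCommGroup V] [InnerProductSpace ℂ V] [CompleteSpace V]
  {W : Type*} [NormedAddCommGroup W] [InnerProductSpace ℂ W] [CompleteSpace W]
  {ι : Type*} [Fintype ι]

theorem inner_rsmul_right (r : ℝ) (x y : V) : inner ℂ x (r • y) = (r : ℂ) * inner ℂ x y := by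
  rw [← Complex.coe_smul, inner_smul_right]

theorem inner_rsmul_left (r : ℝ) (x y : V) : inner ℂ (r • x) y = (r : ℂ) * inner ℂ x y := by
  rw [← Complex.coe_smul, inner_smul_left, Complex.conj_ofReal]

theorem conj_derivSymbol (v ξ : X) : conj (derivSymbol v ξ) = -derivSymbol v ξ := by
  have : (2 * Real.pi * Complex.I * (inner ℝ ξ v : ℝ) : ℂ)
      = ((2 * Real.pi * (inner ℝ ξ v : ℝ) : ℝ) : ℂ) * Complex.I := by push_cast; ring
  rw [derivSymbol, this, map_mul, Complex.conj_ofReal, Complex.conj_I, mul_neg]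

theorem hasWeakDiv_fderiv {Ψ : X → V} (h₁ : ContDiff ℝ 1 Ψ) (h₂ : HasCompactSupport Ψ) (v : X) :
    HasWeakDiv (fun _ : Unit => v) (fun _ => Ψ) (fun x => fderiv ℝ Ψ x v) := by
  intro φ k₁ k₂
  have k₃ : ContDiff ℝ 1 φ := k₁.of_le (by simp)
  simp only [Finset.univ_unique, Finset.sum_const, Finset.card_singleton, one_smul]
  refine integral_smul_fderiv_eq_neg_fderiv_smul_of_integrable (𝕜 := ℝ) ?_ ?_ ?_ ?_ ?_
  · exact integrable_real_smul_of_memLp (memLp_fderiv_of_test k₃ k₂ v)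
      (memLp_of_test h₁.continuous h₂)
  · exact integrable_real_smul_of_memLp (memLp_of_test k₃.continuous k₂)
      (memLp_fderiv_of_test h₁ h₂ v)
  · exact integrable_real_smul_of_memLp (memLp_of_test k₃.continuous k₂)
      (memLp_of_test h₁.continuous h₂)
  · exact fun x _ => k₃.differentiable (by simp) x
  · exact fun x _ => h₁.differentiable (by simp) x

/-- By Plancherel, with the minus sign coming from the purely imaginary derivative symbol. Admitting
test functions that are merely $C^1$ is essential for `HasWeakDiv.product`. -/
theorem HasWeakDiv.integral_inner {e : ι → X} {f : ι → X → V} {g : X → V} (h : HasWeakDiv e f g)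
    (hf : ∀ i, MemLp (f i) 2 volume) (hg : MemLp g 2 volume) {Ψ : X → V} (h₁ : ContDiff ℝ 1 Ψ)
    (h₂ : HasCompactSupport Ψ) :
    ∫ x, inner ℂ (Ψ x) (g x) = -∑ i, ∫ x, inner ℂ (fderiv ℝ Ψ x (e i)) (f i x) := by
  have hΨ := memLp_of_test h₁.continuous h₂
  have hΨ' := fun i => memLp_fderiv_of_test h₁ h₂ (e i)
  have hd : ∀ᵐ ξ, ∀ i, l2Fourier (fun x => fderiv ℝ Ψ x (e i)) ξ
      = derivSymbol (e i) ξ • l2Fourier Ψ ξ := ae_all_iff.2 fun i =>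
    (hasWeakDiv_single hΨ (hΨ' i)).1 (hasWeakDiv_fderiv h₁ h₂ (e i))
  rw [← integral_inner_l2Fourier hΨ hg]
  simp_rw [fun i => (integral_inner_l2Fourier (hΨ' i) (hf i)).symm]
  rw [← integral_finsetSum _ fun i _ =>
    integrable_inner_of_memLp (memLp_l2Fourier _) (memLp_l2Fourier (f i)), ← integral_neg]
  refine integral_congr_ae ?_
  filter_upwards [hd, h.l2Fourier_eq hf hg] with ξ h1 h2
  rw [h2, inner_sum, ← Finset.sum_neg_distrib]
  refine Finset.sum_congr rfl fun i _ => ?_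
  rw [h1, inner_smul_left, inner_smul_right, conj_derivSymbol]
  ring

theorem HasWeakDiv.sum_clm {e : ι → X} {f : X → V} {p : ι → X → V}
    (h : ∀ i, HasWeakDiv (fun _ : Unit => e i) (fun _ => f) (p i)) (hf : MemLp f 2 volume)
    (hp : ∀ i, MemLp (p i) 2 volume) (T : ι → V →L[ℂ] W) :
    HasWeakDiv e (fun i x => T i (f x)) (fun x => ∑ i, T i (p i x)) := by
  intro φ h₁ h₂
  have hφ : MemLp φ 2 volume := memLp_of_test h₁.continuous h₂
  have e1 : ∀ i {g : X → V} {ψ : X → ℝ}, MemLp ψ 2 volume → MemLp g 2 volume →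
      ∫ x, ψ x • T i (g x) = T i (∫ x, ψ x • g x) := fun i g ψ hψ hg => by
    rw [← (T i).integral_comp_comm (integrable_real_smul_of_memLp hψ hg)]
    congr 1; ext x
    exact ((T i).map_smul_of_tower (ψ x) (g x)).symm
  simp_rw [Finset.smul_sum]
  rw [integral_finsetSum _ fun i _ => integrable_real_smul_of_memLp hφ (memLp_clm (T i) (hp i)),
    ← Finset.sum_neg_distrib]
  refine Finset.sum_congr rfl fun i _ => ?_
  have e2 : ∫ x, φ x • p i x = -∫ x, fderiv ℝ φ x (e i) • f x := by simpa using h i φ h₁ h₂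
  rw [e1 i hφ (hp i), e2, map_neg,
    e1 i (memLp_fderiv_of_test (h₁.of_le (by simp)) h₂ (e i)) hf]

/-- Evaluation of the adjoint at a vector, as a real linear map. -/
def adjointApply (w : V) : (V →L[ℂ] V) →L[ℝ] V :=
  LinearMap.mkContinuous
    { toFun := fun T => ContinuousLinearMap.adjoint T w
      map_add' := fun S T => by simp
      map_smul' := fun r T => by
        have : r • T = (r : ℂ) • T := by ext; simp
        rw [this, map_smulₛₗ]; simp } ‖w‖
    fun T => by
      refine (ContinuousLinearMap.le_opNorm (ContinuousLinearMap.adjoint T) w).trans ?_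
      rw [LinearIsometryEquiv.norm_map, mul_comm]

@[simp] theorem adjointApply_apply (w : V) (T : V →L[ℂ] V) :
    adjointApply w T = ContinuousLinearMap.adjoint T w := rfl

theorem l2_product {M : X → V →L[ℂ] V} {K : ℝ} (hM : ContDiff ℝ 1 M) (hK : 0 ≤ K)
    (hb : ∀ x, ‖M x‖ ≤ K) (v : X) (hb' : ∀ x, ‖fderiv ℝ M x v‖ ≤ K)
    {f p : X → V} (hf : MemLp f 2 volume) (hp : MemLp p 2 volume) :
    MemLp (fun x => fderiv ℝ M x v (f x) + M x (p x)) 2 volume ∧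
      l2n (fun x => fderiv ℝ M x v (f x) + M x (p x)) ≤ K * l2n f + K * l2n p := by
  obtain ⟨a1, a2⟩ := l2n_coeff_apply (M := fun x => fderiv ℝ M x v)
    ((hM.continuous_fderiv one_ne_zero).clm_apply continuous_const) hK hb' hf
  obtain ⟨b1, b2⟩ := l2n_coeff_apply hM.continuous hK hb hp
  refine ⟨a1.add b1, ?_⟩
  refine le_trans ?_ (add_le_add a2 b2)
  have := eLpNorm_add_le a1.1 b1.1 (p := 2) (by norm_num)
  have h2 := ENNReal.toReal_mono (ENNReal.add_ne_top.2 ⟨a1.2.ne, b1.2.ne⟩) this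
  rwa [ENNReal.toReal_add a1.2.ne b1.2.ne] at h2

theorem HasWeakDiv.product {M : X → V →L[ℂ] V} {K : ℝ} (hM : ContDiff ℝ 1 M) (hK : 0 ≤ K)
    (hb : ∀ x, ‖M x‖ ≤ K) {v : X} (hb' : ∀ x, ‖fderiv ℝ M x v‖ ≤ K)
    {f p : X → V} (hf : MemLp f 2 volume) (hp : MemLp p 2 volume)
    (h : HasWeakDiv (fun _ : Unit => v) (fun _ => f) p) :
    HasWeakDiv (fun _ : Unit => v) (fun _ x => M x (f x))
      (fun x => fderiv ℝ M x v (f x) + M x (p x)) := by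
  intro φ h₁ h₂
  have h₃ : ContDiff ℝ 1 φ := h₁.of_le (by simp)
  have hφ : MemLp φ 2 volume := memLp_of_test h₁.continuous h₂
  have hφ' := memLp_fderiv_of_test h₃ h₂ v
  obtain ⟨a1, -⟩ := l2_product hM hK hb v hb' hf hp
  obtain ⟨c1, -⟩ := l2n_coeff_apply hM.continuous hK hb hf
  simp only [Finset.univ_unique, Finset.sum_const, Finset.card_singleton, one_smul]
  refine ext_inner_left ℂ fun w => ?_
  rw [inner_neg_right, ← _root_.integral_inner (integrable_real_smul_of_memLp hφ a1),
    ← _root_.integral_inner (integrable_real_smul_of_memLp hφ' c1)]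
  -- Pairing with a constant `w` moves `M` onto the test function as $\varphi M^*w$, which is only
  -- as smooth as `M`. Differentiating it produces exactly the Leibniz terms.
  set Ψ : X → V := fun x => φ x • adjointApply w (M x) with hΨ
  have hΨ₁ : ContDiff ℝ 1 Ψ := h₃.smul ((adjointApply w).contDiff.comp hM)
  have hΨ₂ : HasCompactSupport Ψ := h₂.smul_right
  have key := h.integral_inner (fun _ => hf) hp hΨ₁ hΨ₂
  have hd : ∀ x, fderiv ℝ Ψ x v
      = φ x • adjointApply w (fderiv ℝ M x v) + fderiv ℝ φ x v • adjointApply w (M x) := fun x => by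
    have := ((h₃.differentiable (by simp) x).hasFDerivAt.smul
      ((adjointApply w).hasFDerivAt.comp x (hM.differentiable (by simp) x).hasFDerivAt)).fderiv
    exact congrArg (fun T => T v) this
  simp only [Finset.univ_unique, Finset.sum_const, Finset.card_singleton, one_smul, hd] at key
  have hΨ' : MemLp (fun x => fderiv ℝ Ψ x v) 2 volume := memLp_fderiv_of_test hΨ₁ hΨ₂ v
  simp only [hd] at hΨ'
  have i1 := integrable_inner_of_memLp (memLp_of_test hΨ₁.continuous hΨ₂) hp
  have i2 := integrable_inner_of_memLp hΨ' hf
  have i3 := (integrable_real_smul_of_memLp hφ' c1).const_inner (𝕜 := ℂ) w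
  have hsum : ∫ x, inner ℂ w (φ x • (fderiv ℝ M x v (f x) + M x (p x)))
      = (∫ x, inner ℂ (Ψ x) (p x)) + ((∫ x, inner ℂ (φ x • adjointApply w (fderiv ℝ M x v)
        + fderiv ℝ φ x v • adjointApply w (M x)) (f x))
        - ∫ x, inner ℂ w (fderiv ℝ φ x v • M x (f x))) := by
    rw [← integral_sub i2 i3]
    refine Eq.trans ?_ (integral_add i1 (i2.sub i3))
    congr 1; ext x
    simp only [hΨ, adjointApply_apply, inner_add_left, inner_add_right, inner_rsmul_left,
      inner_rsmul_right, ContinuousLinearMap.adjoint_inner_left]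
    ring
  rw [hsum, key]
  abel

end FormRegularity
end

/-! ### Algebra of alternating forms in components. -/

noncomputable section
namespace FormRegularity
set_option linter.unusedSectionVars false

/-- The constant form `dx^I`. -/
def dxForm {N q : ℕ} (I : Fin q ↪o Fin N) : Form N q :=
  { (Complex.ofRealCLM : ℝ →ₗ[ℝ] ℂ).compAlternatingMap
      ((Matrix.detRowAlternating (R := ℝ) (n := Fin q)).compLinearMap
        (LinearMap.pi fun k => (EuclideanSpace.proj (I k) : Space N →L[ℝ] ℝ).toLinearMap)) with
    cont := by
      refine Complex.continuous_ofReal.comp ?_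
      change Continuous fun v : Fin q → Space N => Matrix.det (Matrix.of fun j k => v j (I k))
      fun_prop }

theorem dxForm_apply {N q : ℕ} (I : Fin q ↪o Fin N) (v : Fin q → Space N) :
    dxForm I v = ((Matrix.det (Matrix.of fun j k => v j (I k)) : ℝ) : ℂ) := rfl

theorem orderEmb_eq_of_range {N q : ℕ} {I J : Fin q ↪o Fin N} (h : Set.range I = Set.range J) :
    I = J := by
  exact DFunLike.coe_injective ((I.strictMono.range_inj J.strictMono).1 h)

theorem component_dxForm {N q : ℕ} (I J : Fin q ↪o Fin N) :
    component (dxForm I) J = if I = J then 1 else 0 := by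
  rw [component, dxForm_apply]
  split_ifs with h
  · subst h
    have : (Matrix.of fun j k => stdVec N (I j) (I k)) = (1 : Matrix (Fin q) (Fin q) ℝ) := by
      ext j k
      simp [stdVec, Matrix.one_apply, eq_comm]
    rw [this, Matrix.det_one]; simp
  · obtain ⟨j, hj⟩ : ∃ j, ∀ k, I k ≠ J j := by
      by_contra hcon
      push Not at hcon
      refine h (orderEmb_eq_of_range ?_).symm
      refine Set.eq_of_subset_of_ncard_le ?_ ?_ (Set.toFinite _)
      · rintro _ ⟨j, rfl⟩
        obtain ⟨k, hk⟩ := hcon j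
        exact ⟨k, hk⟩
      · rw [← Set.image_univ, ← Set.image_univ, Set.ncard_image_of_injective _ I.injective,
          Set.ncard_image_of_injective _ J.injective]
    rw [Matrix.det_eq_zero_of_row_eq_zero j fun k => by simp [stdVec, hj k]]
    simp

/-- Every injective multi-index is a permutation of an ordered one. -/
theorem exists_ordered {N q : ℕ} {f : Fin q → Fin N} (hf : Function.Injective f) :
    ∃ (I : Fin q ↪o Fin N) (σ : Equiv.Perm (Fin q)), I ∘ σ = f := by
  have hm : StrictMono (f ∘ Tuple.sort f) :=
    (Tuple.monotone_sort f).strictMono_of_injective (hf.comp (Tuple.sort f).injective)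
  refine ⟨OrderEmbedding.ofStrictMono _ hm, (Tuple.sort f)⁻¹, ?_⟩
  ext k
  simp

/-- Injective multi-indices are uniquely an ordered one composed with a permutation. Sums over all
multi-indices are easier to reindex than sums over ordered ones. -/
theorem sum_ordered {N q : ℕ} (F : (Fin q → Fin N) → ℂ)
    (h0 : ∀ f, ¬ Function.Injective f → F f = 0)
    (hs : ∀ f (σ : Equiv.Perm (Fin q)), F (f ∘ σ) = F f) :
    ∑ f, F f = (q.factorial : ℂ) * ∑ I : Fin q ↪o Fin N, F I := by
  have h := Fintype.sum_of_injective
    (fun p : (Fin q ↪o Fin N) × Equiv.Perm (Fin q) => (p.1 ∘ p.2 : Fin q → Fin N)) ?_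
    (fun p => F (p.1 ∘ p.2)) F ?_ (fun _ => rfl)
  · rw [← h, Fintype.sum_prod_type]
    simp_rw [hs]
    simp [Finset.mul_sum, Fintype.card_perm]
  · rintro ⟨I, σ⟩ ⟨J, τ⟩ hIJ
    simp only at hIJ
    have hr : I = J := by
      refine orderEmb_eq_of_range ?_
      rw [← σ.surjective.range_comp I, hIJ, τ.surjective.range_comp]
    subst hr
    refine Prod.ext rfl (Equiv.ext fun k => I.injective (congrFun hIJ k))
  · intro f hf
    refine h0 f fun hinj => hf ?_
    obtain ⟨I, σ, h⟩ := exists_ordered hinj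
    exact ⟨(I, σ), h⟩

/-- The value of a form on unit vectors. -/
def stdEval {N q : ℕ} (w : Form N q) (f : Fin q → Fin N) : ℂ := w fun k => stdVec N (f k)

theorem stdEval_eq_zero {N q : ℕ} (w : Form N q) {f : Fin q → Fin N} (hf : ¬ Function.Injective f) :
    stdEval w f = 0 := by
  simp only [Function.Injective, not_forall] at hf
  obtain ⟨i, j, hij, hne⟩ := hf
  exact w.map_eq_zero_of_eq _ (by simp [hij]) hne

theorem stdEval_perm {N q : ℕ} (w : Form N q) (f : Fin q → Fin N) (σ : Equiv.Perm (Fin q)) :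
    stdEval w (f ∘ σ) = Equiv.Perm.sign σ • stdEval w f :=
  w.toAlternatingMap.map_perm (fun k => stdVec N (f k)) σ

theorem factorial_mul_pointInner {N q : ℕ} (w η : Form N q) :
    (q.factorial : ℂ) * pointInner w η = ∑ f, stdEval w f * conj (stdEval η f) := by
  rw [sum_ordered]
  · rfl
  · intro f hf; rw [stdEval_eq_zero w hf, zero_mul]
  · intro f σ
    rw [stdEval_perm, stdEval_perm]
    rcases Int.units_eq_one_or (Equiv.Perm.sign σ) with h | h <;> simp [h]

theorem stdVec_basis (N : ℕ) (i : Fin N) : (EuclideanSpace.basisFun (Fin N) ℝ).toBasis i = stdVec N i := by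
  simp [stdVec]

theorem form_ext {N q : ℕ} {w η : Form N q} (h : ∀ I, component w I = component η I) : w = η := by
  refine ContinuousAlternatingMap.toAlternatingMap_injective ?_
  refine Module.Basis.ext_alternating (EuclideanSpace.basisFun (Fin N) ℝ).toBasis fun f hf => ?_
  simp only [stdVec_basis]
  change stdEval w f = stdEval η f
  obtain ⟨I, σ, rfl⟩ := exists_ordered hf
  rw [stdEval_perm, stdEval_perm]
  congr 1
  exact h I

/-- Forms of degree `q` as vectors of components. -/
abbrev Comp (N q : ℕ) : Type := EuclideanSpace ℂ (Fin q ↪o Fin N)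

/-- The components of a form. -/
def toVec {N q : ℕ} : Form N q ≃ₗ[ℂ] Comp N q where
  toFun w := WithLp.toLp 2 (component w)
  map_add' w η := by ext I; simp [component]
  map_smul' c w := by ext I; simp [component]
  invFun y := ∑ I, y I • dxForm I
  left_inv w := form_ext fun J => by
    have : ∀ (c : (Fin q ↪o Fin N) → ℂ),
        component (∑ I, c I • dxForm I) J = ∑ I, c I * component (dxForm I) J := fun c => by
      simp [component]
    rw [this]
    simp [component_dxForm]
  right_inv y := by
    ext J
    have : ∀ (c : (Fin q ↪o Fin N) → ℂ),
        component (∑ I, c I • dxForm I) J = ∑ I, c I * component (dxForm I) J := fun c => by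
      simp [component]
    change component (∑ I, y I • dxForm I) J = y J
    rw [this]
    simp [component_dxForm]

theorem toVec_apply {N q : ℕ} (w : Form N q) (I : Fin q ↪o Fin N) : toVec w I = component w I := rfl

/-- The arguments swap because `inner` is conjugate linear in its first slot. -/
theorem pointInner_eq {N q : ℕ} (w η : Form N q) : pointInner w η = inner ℂ (toVec η) (toVec w) := by
  simp [pointInner, PiLp.inner_apply, toVec_apply]

/-- The form `dx^i ∧ w`. -/
def wedge {N q : ℕ} (i : Fin N) : Form N q →ₗ[ℂ] Form N (q + 1) where
  toFun w := ContinuousAlternatingMap.alternatizeUncurryFin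
    ((EuclideanSpace.proj i : Space N →L[ℝ] ℝ).smulRight w)
  map_add' w η := by
    ext v; simp [ContinuousAlternatingMap.alternatizeUncurryFin_apply, Finset.sum_add_distrib]
  map_smul' c w := by
    ext v; simp [ContinuousAlternatingMap.alternatizeUncurryFin_apply, Finset.mul_sum]
    refine Finset.sum_congr rfl fun k _ => ?_
    ring

theorem wedge_apply {N q : ℕ} (i : Fin N) (w : Form N q) (v : Fin (q + 1) → Space N) :
    wedge i w v = ∑ k : Fin (q + 1), (-1) ^ (k : ℕ) * ((v k i : ℝ) : ℂ) * w (k.removeNth v) := by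
  simp [wedge, ContinuousAlternatingMap.alternatizeUncurryFin_apply, mul_assoc]

/-- The interior product of a form with the unit vector `e_i`. -/
def contr {N q : ℕ} (i : Fin N) : Form N (q + 1) →ₗ[ℂ] Form N q where
  toFun w := w.curryLeft (stdVec N i)
  map_add' _ _ := rfl
  map_smul' _ _ := rfl

theorem contr_apply {N q : ℕ} (i : Fin N) (w : Form N (q + 1)) (v : Fin q → Space N) :
    contr i w v = w (Matrix.vecCons (stdVec N i) v) := rfl

/-- After multiplication by $(q+1)!$ both sides are sums over all multi-indices. In the $k$-th term
of the wedge, slot $k$ must carry $i$; moving it to the front of `w` costs $(-1)^k$, cancelling the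
alternating sign. The $q+1$ equal terms account for $(q+1)!=(q+1)\,q!$. -/
theorem pointInner_wedge {N q : ℕ} (i : Fin N) (u : Form N q) (w : Form N (q + 1)) :
    pointInner (wedge i u) w = pointInner u (contr i w) := by
  have hne : ((q + 1).factorial : ℂ) ≠ 0 := by exact_mod_cast Nat.factorial_ne_zero _
  refine mul_left_cancel₀ hne ?_
  rw [factorial_mul_pointInner, Nat.factorial_succ, Nat.cast_mul, mul_assoc,
    factorial_mul_pointInner]
  have h1 : ∀ k : Fin (q + 1), ∑ g : Fin (q + 1) → Fin N, (-1) ^ (k : ℕ)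
      * ((stdVec N (g k) i : ℝ) : ℂ) * stdEval u (k.removeNth g) * conj (stdEval w g)
      = ∑ f, stdEval u f * conj (stdEval (contr i w) f) := fun k => by
    rw [← (Fin.insertNthEquiv (fun _ => Fin N) k).sum_comp, Fintype.sum_prod_type,
      Finset.sum_comm]
    refine Finset.sum_congr rfl fun f _ => ?_
    have h2 : ∀ j, stdEval w (k.insertNth j f) = (-1) ^ (k : ℕ) * stdEval (contr j w) f := fun j => by
      have h3 : (fun l => stdVec N (k.insertNth (α := fun _ => Fin N) j f l))
          = k.insertNth (stdVec N j) (fun l => stdVec N (f l)) := by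
        ext l : 1
        refine Fin.succAboveCases k ?_ (fun m => ?_) l <;> simp
      rw [stdEval, h3, ContinuousAlternatingMap.map_insertNth]
      simp [stdEval, contr_apply]
    have h4 : (-1 : ℂ) ^ (k : ℕ) * (-1) ^ (k : ℕ) = 1 := by
      rw [← mul_pow]; simp
    have h6 : ∀ j, Fin.insertNthEquiv (fun _ => Fin N) k (j, f)
        = k.insertNth (α := fun _ => Fin N) j f := fun _ => rfl
    simp only [h6, Fin.insertNth_apply_same, Fin.removeNth_insertNth, h2,
      map_mul, map_pow, map_neg, map_one]
    rw [Finset.sum_eq_single i]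
    · have h7 : ((stdVec N i i : ℝ) : ℂ) = 1 := by simp [stdVec]
      rw [h7]
      linear_combination (stdEval u f * conj (stdEval (contr i w) f)) * h4
    · intro j _ hj
      simp [stdVec, hj.symm]
    · simp
  have h5 : ∀ g : Fin (q + 1) → Fin N, stdEval (wedge i u) g * conj (stdEval w g)
      = ∑ k : Fin (q + 1), (-1) ^ (k : ℕ)
      * ((stdVec N (g k) i : ℝ) : ℂ) * stdEval u (k.removeNth g) * conj (stdEval w g) := fun g => by
    rw [stdEval, wedge_apply, Finset.sum_mul]
    rfl
  simp_rw [h5]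
  rw [Finset.sum_comm, Finset.sum_congr rfl fun k _ => h1 k]
  simp

theorem contr_wedge_zero {N : ℕ} (i j : Fin N) (w : Form N 0) :
    contr j (wedge i w) = (if i = j then (1 : ℂ) else 0) • w := by
  ext v
  rw [contr_apply, wedge_apply]
  simp [stdVec]
  split_ifs <;> simp

/-- In the expansion of the wedge, the term where $dx^i$ meets $e_j$ gives the Kronecker delta; the
others keep $e_j$ as first argument of `w`, with the sign shifted by one. -/
theorem contr_wedge {N q : ℕ} (i j : Fin N) (w : Form N (q + 1)) :
    contr j (wedge i w) = (if i = j then (1 : ℂ) else 0) • w - wedge i (contr j w) := by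
  ext v
  rw [contr_apply, wedge_apply, Fin.sum_univ_succ]
  change _ = (if i = j then (1 : ℂ) else 0) * w v - wedge i (contr j w) v
  rw [wedge_apply, sub_eq_add_neg, ← Finset.sum_neg_distrib]
  congr 1
  · simp [stdVec]
    split_ifs <;> simp
  · refine Finset.sum_congr rfl fun k _ => ?_
    have : k.succ.removeNth (Matrix.vecCons (stdVec N j) v)
        = Matrix.vecCons (stdVec N j) (k.removeNth v) := by
      ext l : 1
      refine Fin.cases ?_ (fun m => ?_) l
      · simp [Fin.removeNth]
      · simp [Fin.removeNth]
    rw [this, contr_apply]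
    simp [pow_succ]

end FormRegularity
end

/-! ### Weak $d$, $\delta$ and $\partial_i$ as weak divergences of component vectors. -/

noncomputable section
namespace FormRegularity
set_option linter.unusedSectionVars false

section Duality

variable {X : Type*} [NormedAddCommGroup X] [InnerProductSpace ℝ X] [FiniteDimensional ℝ X]
  [MeasurableSpace X] [BorelSpace X]
  {V : Type*} [NormedAddCommGroup V] [InnerProductSpace ℂ V] [CompleteSpace V]
  {W : Type*} [NormedAddCommGroup W] [InnerProductSpace ℂ W] [CompleteSpace W]
  {ι : Type*} [Fintype ι]

theorem adjoint_opSymbol (e : ι → X) (a : ι → V →L[ℂ] W) (ξ : X) :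
    ContinuousLinearMap.adjoint (opSymbol e a ξ)
      = opSymbol e (fun i => ContinuousLinearMap.adjoint (a i)) ξ := by
  simp only [opSymbol, map_sum, map_smulₛₗ, Complex.conj_ofReal]

/-- The weak equation `∑ i, a i ∂_{e i} f = g`, tested with vector valued functions. -/
theorem hasWeakDiv_iff_inner {e : ι → X} {a : ι → V →L[ℂ] W} {f : X → V} {g : X → W}
    (hf : MemLp f 2 volume) (hg : MemLp g 2 volume) :
    HasWeakDiv e (fun i x => a i (f x)) g ↔
      ∀ Ψ : X → W, ContDiff ℝ ∞ Ψ → HasCompactSupport Ψ →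
        ∫ x, inner ℂ (Ψ x) (g x)
          = -∫ x, inner ℂ (∑ i, ContinuousLinearMap.adjoint (a i) (fderiv ℝ Ψ x (e i))) (f x) := by
  have hint : ∀ Ψ : X → W, ContDiff ℝ ∞ Ψ → HasCompactSupport Ψ →
      ∫ x, inner ℂ (∑ i, ContinuousLinearMap.adjoint (a i) (fderiv ℝ Ψ x (e i))) (f x)
        = ∑ i, ∫ x, inner ℂ (fderiv ℝ Ψ x (e i)) (a i (f x)) := fun Ψ h₁ h₂ => by
    simp_rw [sum_inner, ContinuousLinearMap.adjoint_inner_left]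
    exact integral_finsetSum _ fun i _ => integrable_inner_of_memLp
      (memLp_fderiv_of_test (h₁.of_le (by simp)) h₂ (e i)) (memLp_clm (a i) hf)
  constructor
  · intro h Ψ h₁ h₂
    rw [hint Ψ h₁ h₂]
    exact h.integral_inner (fun i => memLp_clm (a i) hf) hg (h₁.of_le (by simp)) h₂
  · intro h φ h₁ h₂
    have hφ : MemLp φ 2 volume := memLp_of_test h₁.continuous h₂
    have hφ' := fun i => memLp_fderiv_of_test (h₁.of_le (by simp)) h₂ (e i)
    refine ext_inner_left ℂ fun w => ?_
    have hΨ₁ : ContDiff ℝ ∞ (fun x => φ x • w) := h₁.smul contDiff_const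
    have hΨ₂ : HasCompactSupport (fun x => φ x • w) := h₂.smul_right
    have key := h _ hΨ₁ hΨ₂
    rw [hint _ hΨ₁ hΨ₂] at key
    have hd : ∀ x v, fderiv ℝ (fun x => φ x • w) x v = fderiv ℝ φ x v • w := fun x v => by
      have := ((h₁.differentiable (by simp) x).hasFDerivAt.smul_const w).fderiv
      exact congrArg (fun T => T v) this
    simp only [hd, inner_rsmul_left] at key
    rw [inner_neg_right, inner_sum, ← _root_.integral_inner (integrable_real_smul_of_memLp hφ hg)]
    simp_rw [fun i => (_root_.integral_inner (𝕜 := ℂ)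
      (integrable_real_smul_of_memLp (hφ' i) (memLp_clm (a i) hf)) w).symm, inner_rsmul_right]
    exact key

end Duality

instance {N q : ℕ} : FiniteDimensional ℝ (Form N q) :=
  (toVec.restrictScalars ℝ : Form N q ≃ₗ[ℝ] Comp N q).symm.finiteDimensional

/-- `toVec` as a continuous real linear equivalence. -/
def toVecR {N q : ℕ} : Form N q ≃L[ℝ] Comp N q :=
  (toVec.restrictScalars ℝ : Form N q ≃ₗ[ℝ] Comp N q).toContinuousLinearEquiv

/-- The component vector of a differential form. -/
def vec {N q : ℕ} (E : Space N → Form N q) : Space N → Comp N q := fun x => toVec (E x)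

theorem isL2_iff {N q : ℕ} {E : Space N → Form N q} : IsL2 E ↔ MemLp (vec E) 2 volume := by
  rw [memLp_piLp_iff]; rfl

theorem l2NormSq_eq {N q : ℕ} {E : Space N → Form N q} (h : MemLp (vec E) 2 volume) :
    l2NormSq E = l2n (vec E) ^ 2 := by
  rw [l2n_sq h, l2NormSq]
  congr 1; ext x
  rw [EuclideanSpace.norm_sq_eq]; rfl

theorem l2Inner_eq {N q : ℕ} (E H : Space N → Form N q) :
    l2Inner E H = ∫ x, inner ℂ (vec H x) (vec E x) := by
  simp_rw [l2Inner, pointInner_eq]; rfl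

theorem isTestForm_iff {N q : ℕ} {Φ : Space N → Form N q} :
    IsTestForm Φ ↔ ContDiff ℝ ∞ (vec Φ) ∧ HasCompactSupport (vec Φ) := by
  refine and_congr ?_ ?_
  · exact (toVecR.comp_contDiff_iff (f := Φ)).symm
  · have : Function.support (vec Φ) = Function.support Φ := by
      ext x; simp [vec]
    rw [HasCompactSupport, HasCompactSupport, tsupport, tsupport, this]

theorem fderiv_vec {N q : ℕ} {Φ : Space N → Form N q} (x v : Space N) :
    fderiv ℝ (vec Φ) x v = toVec (fderiv ℝ Φ x v) := by
  have := toVecR.comp_fderiv (f := Φ) (x := x)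
  exact congrArg (fun T => T v) this

theorem vec_symm {N q : ℕ} (y : Space N → Comp N q) : vec (fun x => toVec.symm (y x)) = y := by
  ext x : 1; simp [vec]

/-- A weak equation between forms in terms of components. -/
theorem weak_iff {N q r : ℕ} {a : Fin N → Comp N q →L[ℂ] Comp N r}
    {D : (Space N → Form N r) → Space N → Form N q}
    (hD : ∀ Φ, IsTestForm Φ → ∀ x, toVec (D Φ x)
      = ∑ i, ContinuousLinearMap.adjoint (a i) (toVec (fderiv ℝ Φ x (stdVec N i))))
    {E : Space N → Form N q} {G : Space N → Form N r}
    (hE : MemLp (vec E) 2 volume) (hG : MemLp (vec G) 2 volume) :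
    (∀ Φ, IsTestForm Φ → l2Inner G Φ = -l2Inner E (D Φ)) ↔
      HasWeakDiv (stdVec N) (fun i x => a i (vec E x)) (vec G) := by
  rw [hasWeakDiv_iff_inner hE hG]
  constructor
  · intro h Ψ h₁ h₂
    have hΦ : IsTestForm fun x => toVec.symm (Ψ x) := by
      rw [isTestForm_iff, vec_symm]; exact ⟨h₁, h₂⟩
    have := h _ hΦ
    rw [l2Inner_eq, l2Inner_eq, vec_symm] at this
    rw [this]
    congr 2; ext x
    change inner ℂ (toVec (D _ x)) _ = _
    rw [hD _ hΦ]
    simp_rw [← fderiv_vec, vec_symm]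
  · intro h Φ hΦ
    have h2 := isTestForm_iff.1 hΦ
    rw [l2Inner_eq, l2Inner_eq, h _ h2.1 h2.2]
    congr 2; ext x
    change _ = inner ℂ (toVec (D _ x)) _
    rw [hD _ hΦ]
    simp_rw [fderiv_vec]

/-- `dx^i ∧ ·` on component vectors. -/
def wedgeVec {N q : ℕ} (i : Fin N) : Comp N q →L[ℂ] Comp N (q + 1) :=
  LinearMap.toContinuousLinearMap (toVec.toLinearMap ∘ₗ wedge i ∘ₗ toVec.symm.toLinearMap)

/-- The interior product with `e_i` on component vectors. -/
def contrVec {N q : ℕ} (i : Fin N) : Comp N (q + 1) →L[ℂ] Comp N q :=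
  LinearMap.toContinuousLinearMap (toVec.toLinearMap ∘ₗ contr i ∘ₗ toVec.symm.toLinearMap)

theorem wedgeVec_toVec {N q : ℕ} (i : Fin N) (w : Form N q) :
    wedgeVec i (toVec w) = toVec (wedge i w) := by
  change toVec (wedge i (toVec.symm (toVec w))) = _
  rw [LinearEquiv.symm_apply_apply]

theorem contrVec_toVec {N q : ℕ} (i : Fin N) (w : Form N (q + 1)) :
    contrVec i (toVec w) = toVec (contr i w) := by
  change toVec (contr i (toVec.symm (toVec w))) = _
  rw [LinearEquiv.symm_apply_apply]

theorem adjoint_contrVec {N q : ℕ} (i : Fin N) :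
    ContinuousLinearMap.adjoint (contrVec i : Comp N (q + 1) →L[ℂ] Comp N q) = wedgeVec i := by
  refine ((ContinuousLinearMap.eq_adjoint_iff _ _).2 fun x y => ?_).symm
  obtain ⟨u, rfl⟩ := toVec.surjective x
  obtain ⟨w, rfl⟩ := toVec.surjective y
  rw [wedgeVec_toVec, contrVec_toVec, ← inner_conj_symm, ← pointInner_eq, pointInner_wedge,
    pointInner_eq, inner_conj_symm]

theorem adjoint_wedgeVec {N q : ℕ} (i : Fin N) :
    ContinuousLinearMap.adjoint (wedgeVec i : Comp N q →L[ℂ] Comp N (q + 1)) = contrVec i := by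
  rw [← adjoint_contrVec, ContinuousLinearMap.adjoint_adjoint]

theorem coDeriv_vec {N q : ℕ} (Φ : Space N → Form N (q + 1)) (x : Space N) :
    toVec (coDeriv Φ x) = ∑ i, contrVec i (toVec (fderiv ℝ Φ x (stdVec N i))) := by
  simp_rw [contrVec_toVec, coDeriv, map_sum]; rfl

theorem eq_sum_stdVec {N : ℕ} (v : Space N) : v = ∑ i, v i • stdVec N i := by
  simpa [stdVec] using ((EuclideanSpace.basisFun (Fin N) ℝ).sum_repr v).symm

theorem extDeriv_vec {N q : ℕ} (Φ : Space N → Form N q) (x : Space N) :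
    toVec (extDeriv Φ x) = ∑ i, wedgeVec i (toVec (fderiv ℝ Φ x (stdVec N i))) := by
  simp_rw [wedgeVec_toVec]
  rw [← map_sum]
  congr 1
  ext v
  simp only [extDeriv, ContinuousAlternatingMap.alternatizeUncurryFin_apply,
    ContinuousAlternatingMap.sum_apply, wedge_apply]
  rw [Finset.sum_comm]
  refine Finset.sum_congr rfl fun k _ => ?_
  conv_lhs => rw [eq_sum_stdVec (v k)]
  simp [Finset.mul_sum, mul_assoc]

theorem hasWeakExtDeriv_iff {N q : ℕ} {E : Space N → Form N q} {G : Space N → Form N (q + 1)} :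
    HasWeakExtDeriv E G ↔ MemLp (vec E) 2 volume ∧ MemLp (vec G) 2 volume ∧
      HasWeakDiv (stdVec N) (fun i x => wedgeVec i (vec E x)) (vec G) := by
  rw [HasWeakExtDeriv, isL2_iff, isL2_iff]
  refine and_congr_right fun hE => and_congr_right fun hG => ?_
  exact weak_iff (a := wedgeVec) (fun Φ _ x => by simp_rw [adjoint_wedgeVec, coDeriv_vec]) hE hG

/-- The components of the co-derivative's symbol; zero on `0`-forms. -/
def coVec {N : ℕ} : {q : ℕ} → Fin N → Comp N q →L[ℂ] Comp N (q - 1)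
  | 0, _ => 0
  | _ + 1, i => contrVec i

/-- In degree $0$ the truncated degree $q-1$ is again $0$. There `coVec` vanishes, so the weak
equation forces `F` to vanish almost everywhere, as the definition demands. -/
theorem hasWeakCoDeriv_iff {N q : ℕ} {H : Space N → Form N q} {F : Space N → Form N (q - 1)} :
    HasWeakCoDeriv H F ↔ MemLp (vec H) 2 volume ∧ MemLp (vec F) 2 volume ∧
      HasWeakDiv (stdVec N) (fun i x => coVec i (vec H x)) (vec F) := by
  cases q with
  | zero =>
    rw [HasWeakCoDeriv, isL2_iff]
    refine and_congr_right fun _ => ⟨fun hF => ?_, fun ⟨hF, h⟩ => ?_⟩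
    · have h0 : vec F =ᵐ[volume] fun _ => 0 := by
        filter_upwards [hF] with x hx
        simp [vec, hx]
      refine ⟨(memLp_congr_ae h0).2 MemLp.zero', fun φ _ _ => ?_⟩
      rw [integral_congr_ae (g := fun _ => 0) (by filter_upwards [h0] with x hx; simp [hx])]
      simp [coVec]
    · have : ∀ᵐ x, vec F x = 0 := by
        refine ae_eq_zero_of_integral_contDiff_smul_eq_zero (locallyIntegrable_of_memLp_two hF) fun φ h₁ h₂ => ?_
        rw [h φ h₁ h₂]
        simp [coVec]
      filter_upwards [this] with x hx
      exact toVec.map_eq_zero_iff.1 hx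
  | succ q =>
    rw [HasWeakCoDeriv, isL2_iff, isL2_iff]
    refine and_congr_right fun hE => and_congr_right fun hG => ?_
    exact weak_iff (a := contrVec) (D := extDeriv)
      (fun Φ _ x => by simp_rw [adjoint_contrVec, extDeriv_vec]) hE hG

theorem inner_stdVec {N : ℕ} (ξ : Space N) (i : Fin N) : inner ℝ ξ (stdVec N i) = ξ i := by
  rw [stdVec, EuclideanSpace.inner_single_right]; simp

theorem sum_sq_smul {N q : ℕ} (ξ : Space N) (y : Comp N q) :
    ∑ i, ∑ j, (ξ j : ℂ) • (ξ i : ℂ) • (if i = j then (1 : ℂ) else 0) • y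
      = ((‖ξ‖ ^ 2 : ℝ) : ℂ) • y := by
  rw [EuclideanSpace.norm_sq_eq]
  simp only [Real.norm_eq_abs, sq_abs, ite_smul, one_smul, zero_smul, smul_ite, smul_zero,
    Finset.sum_ite_eq, Finset.mem_univ, if_true, smul_smul, ← Finset.sum_smul]
  congr 1
  push_cast
  simp [sq]

/-- Symbol version of $d\delta+\delta d=\Delta$: the Kronecker deltas in the anticommutation rule
sum to $|\xi|^2$. -/
theorem isHodgePair_wedge_co (N q : ℕ) :
    IsHodgePair (stdVec N) (wedgeVec : Fin N → Comp N q →L[ℂ] Comp N (q + 1)) coVec := by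
  intro ξ y
  obtain ⟨w, rfl⟩ := toVec.surjective y
  rw [adjoint_opSymbol, adjoint_opSymbol]
  simp_rw [adjoint_wedgeVec]
  rw [← sum_sq_smul]
  simp only [opSymbol, inner_stdVec, _root_.sum_apply, _root_.smul_apply, map_sum, map_smul]
  cases q with
  | zero =>
    simp only [coVec, map_zero, _root_.zero_apply, smul_zero, Finset.sum_const_zero, add_zero,
      wedgeVec_toVec, contrVec_toVec, contr_wedge_zero, map_smul]
    simp only [Finset.smul_sum]
    exact Finset.sum_congr rfl fun i _ => Finset.sum_congr rfl fun j _ => smul_comm _ _ _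
  | succ q =>
    simp only [coVec, adjoint_contrVec, wedgeVec_toVec, contrVec_toVec, contr_wedge, map_smul,
      map_sub]
    simp only [Finset.smul_sum, smul_sub, Finset.sum_sub_distrib]
    -- The mixed terms of the two compositions agree after exchanging the summation indices, hence
    -- cancel.
    have h1 : ∑ i, ∑ j, (ξ i : ℂ) • (ξ j : ℂ) • toVec (wedge j (contr i w))
        = ∑ i, ∑ j, (ξ i : ℂ) • (ξ j : ℂ) • toVec (wedge i (contr j w)) := by
      rw [Finset.sum_comm]
      exact Finset.sum_congr rfl fun i _ => Finset.sum_congr rfl fun j _ => smul_comm _ _ _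
    rw [h1, sub_add_cancel]
    exact Finset.sum_congr rfl fun i _ => Finset.sum_congr rfl fun j _ => smul_comm _ _ _

theorem hasWeakPartial_iff {N q : ℕ} {i : Fin N} {E P : Space N → Form N q} :
    HasWeakPartial i E P ↔ MemLp (vec E) 2 volume ∧ MemLp (vec P) 2 volume ∧
      HasWeakDiv (fun _ : Unit => stdVec N i) (fun _ => vec E) (vec P) := by
  rw [HasWeakPartial, isL2_iff, isL2_iff]
  refine and_congr_right fun hE => and_congr_right fun hP => ?_
  have hproj : ∀ {ψ : Space N → ℝ} {H : Space N → Form N q} (I : Fin q ↪o Fin N),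
      MemLp ψ 2 volume → MemLp (vec H) 2 volume →
      (∫ x, ψ x • vec H x) I = ∫ x, ψ x • component (H x) I := fun {ψ H} I hψ hH =>
    ((EuclideanSpace.proj I : Comp N q →L[ℂ] ℂ).integral_comp_comm
      (integrable_real_smul_of_memLp hψ hH)).symm
  have key : ∀ φ : Space N → ℝ, ContDiff ℝ ∞ φ → HasCompactSupport φ →
      ((∫ x, φ x • vec P x = -∑ _ : Unit, ∫ x, fderiv ℝ φ x (stdVec N i) • vec E x) ↔
      ∀ I, ∫ x, φ x • component (P x) I
        = -∫ x, fderiv ℝ φ x (stdVec N i) • component (E x) I) := fun φ h₁ h₂ => by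
    have hφ : MemLp φ 2 volume := memLp_of_test h₁.continuous h₂
    have hφ' := memLp_fderiv_of_test (h₁.of_le (by simp)) h₂ (stdVec N i)
    simp only [Finset.univ_unique, Finset.sum_const, Finset.card_singleton, one_smul]
    rw [PiLp.ext_iff]
    refine forall_congr' fun I => ?_
    rw [PiLp.neg_apply, hproj I hφ hP, hproj I hφ' hE]
  constructor
  · exact fun h φ h₁ h₂ => (key φ h₁ h₂).2 fun I => h I φ h₁ h₂
  · exact fun h I φ h₁ h₂ => (key φ h₁ h₂).1 (h φ h₁ h₂) I

end FormRegularity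
end

/-! ### Bounds for the coefficient field. -/

noncomputable section
namespace FormRegularity
set_option linter.unusedSectionVars false

/-- Finite sums of bounded `C¹` functions with bounded derivatives have the same property. -/
theorem exists_bound_sum_smul {X Y κ : Type*} [NormedAddCommGroup X] [NormedSpace ℝ X]
    [NormedAddCommGroup Y] [NormedSpace ℂ Y] [Fintype κ] {m : κ → X → ℂ}
    (hm : ∀ k, ContDiff ℝ 1 (m k)) (hb : ∀ k, ∃ K : ℝ, ∀ x, ‖m k x‖ ≤ K)
    (hb' : ∀ k, ∃ K : ℝ, ∀ x, ‖fderiv ℝ (m k) x‖ ≤ K) (T : κ → Y) :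
    ContDiff ℝ 1 (fun x => ∑ k, m k x • T k) ∧ ∃ K : ℝ, 0 ≤ K ∧
      (∀ x, ‖∑ k, m k x • T k‖ ≤ K) ∧ ∀ x, ‖fderiv ℝ (fun x => ∑ k, m k x • T k) x‖ ≤ K := by
  choose K hK using hb
  choose L hL using hb'
  have hc : ContDiff ℝ 1 (fun x => ∑ k, m k x • T k) :=
    ContDiff.sum fun k _ => (hm k).smul contDiff_const
  refine ⟨hc, max 0 (max (∑ k, K k * ‖T k‖) (∑ k, L k * ‖T k‖)), le_max_left _ _, fun x => ?_,
    fun x => ?_⟩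
  · refine le_trans ?_ ((le_max_left _ _).trans (le_max_right _ _))
    refine (norm_sum_le _ _).trans (Finset.sum_le_sum fun k _ => ?_)
    rw [norm_smul]
    exact mul_le_mul_of_nonneg_right (hK k x) (norm_nonneg _)
  · refine le_trans ?_ ((le_max_right _ _).trans (le_max_right _ _))
    have hd : HasFDerivAt (fun x => ∑ k, m k x • T k)
        (∑ k, (fderiv ℝ (m k) x).smulRight (T k)) x :=
      HasFDerivAt.fun_sum fun k _ => ((hm k).differentiable (by simp) x).hasFDerivAt.smul_const (T k)
    rw [hd.fderiv]
    refine (norm_sum_le _ _).trans (Finset.sum_le_sum fun k _ => ?_)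
    refine ContinuousLinearMap.opNorm_le_bound _
      (mul_nonneg ((norm_nonneg _).trans (hL k x)) (norm_nonneg _)) fun v => ?_
    rw [ContinuousLinearMap.smulRight_apply, norm_smul, mul_right_comm]
    exact mul_le_mul_of_nonneg_right (((fderiv ℝ (m k) x).le_opNorm v).trans
      (mul_le_mul_of_nonneg_right (hL k x) (norm_nonneg _))) (norm_nonneg _)

/-- A transformation as a field of linear maps of component vectors. -/
def Transformation.field {N q : ℕ} (ε : Transformation N q) (x : Space N) :
    Comp N q →L[ℂ] Comp N q :=
  LinearMap.toContinuousLinearMap (toVec.toLinearMap ∘ₗ ε x ∘ₗ toVec.symm.toLinearMap)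

theorem vec_app {N q : ℕ} (ε : Transformation N q) (E : Space N → Form N q) :
    vec (ε.app E) = fun x => ε.field x (vec E x) := by
  ext x : 1
  change _ = toVec (ε x (toVec.symm (toVec (E x))))
  rw [LinearEquiv.symm_apply_apply]; rfl

/-- The matrix unit with entry `1` in row `I` and column `J`. -/
def matrixUnit {N q : ℕ} (p : (Fin q ↪o Fin N) × (Fin q ↪o Fin N)) : Comp N q →L[ℂ] Comp N q :=
  (EuclideanSpace.proj p.2 : Comp N q →L[ℂ] ℂ).smulRight (EuclideanSpace.single p.1 (1 : ℂ))

theorem field_eq_sum {N q : ℕ} (ε : Transformation N q) :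
    ε.field = fun x => ∑ p : (Fin q ↪o Fin N) × (Fin q ↪o Fin N),
      coefficient ε (dxForm p.2) p.1 x • matrixUnit p := by
  ext x y I
  have h1 : toVec.symm y = ∑ J, y J • dxForm J := rfl
  have h2 : ε.field x y I = ∑ J, y J * coefficient ε (dxForm J) I x := by
    change toVec (ε x (toVec.symm y)) I = _
    rw [h1]
    simp only [map_sum, map_smul]
    simp [toVec_apply, coefficient]
  rw [h2, Fintype.sum_prod_type]
  simp only [_root_.sum_apply, _root_.smul_apply, matrixUnit, ContinuousLinearMap.smulRight_apply,
    PiLp.proj_apply, PiLp.smul_apply, WithLp.ofLp_sum, Finset.sum_apply, smul_eq_mul]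
  symm
  rw [Finset.sum_eq_single I]
  · simp [mul_comm]
  · intro J _ hJ
    simp [hJ.symm]
  · simp

/-- Expansion in matrix units carries the entrywise bounds to the operator field; the Lipschitz
bound is the mean value inequality, so one `K` bounds the field, its derivative and its Lipschitz
constant. -/
theorem IsCmAdmissible.exists_field_bound {N q : ℕ} {ε : Transformation N q}
    (hε : IsCmAdmissible 1 ε) :
    ContDiff ℝ 1 ε.field ∧ ∃ c K : ℝ, (∀ x, ‖fderiv ℝ ε.field x‖ ≤ K) ∧
      IsLipschitzCoeff ε.field c K := by
  obtain ⟨h1, K, hK, hb, hb'⟩ := exists_bound_sum_smul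
    (m := fun p : (Fin q ↪o Fin N) × (Fin q ↪o Fin N) => coefficient ε (dxForm p.2) p.1)
    (fun p => by exact_mod_cast hε.contDiff _ _)
    (fun p => by
      obtain ⟨K, hK⟩ := hε.bounded_deriv (dxForm p.2) p.1 0 (by simp)
      exact ⟨K, fun x => by simpa using hK x⟩)
    (fun p => by
      obtain ⟨K, hK⟩ := hε.bounded_deriv (dxForm p.2) p.1 1 le_rfl
      exact ⟨K, fun x => by simpa [norm_iteratedFDeriv_one] using hK x⟩) matrixUnit
  rw [← field_eq_sum] at h1 hb'
  obtain ⟨c, hc, hcoer⟩ := hε.posDef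
  refine ⟨h1, c, K, hb', h1.continuous, hc, hK, fun x => ?_, fun x y => ?_, fun f hf => ?_⟩
  · rw [field_eq_sum]; exact hb x
  · exact convex_univ.norm_image_sub_le_of_norm_fderiv_le
      (fun z _ => h1.differentiable (by simp) z) (fun z _ => hb' z) (Set.mem_univ y) (Set.mem_univ x)
  · have hv := vec_symm (N := N) (q := q) f
    have hE : MemLp (vec fun x => toVec.symm (f x)) 2 volume := by rwa [hv]
    have := hcoer _ (isL2_iff.2 hE)
    rw [l2NormSq_eq hE, l2Inner_eq, vec_app, hv] at this
    exact this

section Sums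

variable {X : Type*} [NormedAddCommGroup X] [InnerProductSpace ℝ X] [FiniteDimensional ℝ X]
  [MeasurableSpace X] [BorelSpace X]
  {V : Type*} [NormedAddCommGroup V] [InnerProductSpace ℂ V] [CompleteSpace V]
  {W : Type*} [NormedAddCommGroup W] [InnerProductSpace ℂ W] [CompleteSpace W]
  {ι : Type*} [Fintype ι]

theorem l2n_sum_clm (T : ι → V →L[ℂ] W) {p : ι → X → V} (hp : ∀ i, MemLp (p i) 2 volume) :
    MemLp (fun x => ∑ i, T i (p i x)) 2 volume ∧
      l2n (fun x => ∑ i, T i (p i x)) ≤ ∑ i, ‖T i‖ * l2n (p i) := by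
  have h1 : ∀ i, MemLp (fun x => T i (p i x)) 2 volume ∧
      l2n (fun x => T i (p i x)) ≤ ‖T i‖ * l2n (p i) := fun i =>
    l2n_le_of_bound (memLp_clm (T i) (hp i)).1 (hp i) (norm_nonneg _)
      (ae_of_all _ fun x => (T i).le_opNorm _)
  refine ⟨memLp_finsetSum _ fun i _ => (h1 i).1, le_trans ?_ (Finset.sum_le_sum fun i _ => (h1 i).2)⟩
  have h2 : eLpNorm (∑ i, fun x => T i (p i x)) 2 volume
      ≤ ∑ i, eLpNorm (fun x => T i (p i x)) 2 volume :=
    eLpNorm_sum_le (fun i _ => (h1 i).1.1) (by norm_num)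
  have h3 := ENNReal.toReal_mono (ENNReal.sum_ne_top.2 fun i _ => (h1 i).1.2.ne) h2
  rw [ENNReal.toReal_sum fun i _ => (h1 i).1.2.ne] at h3
  have h4 : (∑ i, fun x => T i (p i x)) = fun x => ∑ i, T i (p i x) := by ext x; simp
  rw [h4] at h3
  exact h3

theorem HasWeakDiv.ae_unique {e : ι → X} {f : ι → X → V} {g g' : X → V}
    (hg : MemLp g 2 volume) (hg' : MemLp g' 2 volume) (h : HasWeakDiv e f g)
    (h' : HasWeakDiv e f g') : g =ᵐ[volume] g' := by
  refine ae_eq_of_integral_contDiff_smul_eq (locallyIntegrable_of_memLp_two hg) (locallyIntegrable_of_memLp_two hg') fun φ h₁ h₂ => ?_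
  rw [h φ h₁ h₂, h' φ h₁ h₂]

end Sums

/-! ### Both inclusions and the comparison of norms. -/

theorem norm_stdVec {N : ℕ} (i : Fin N) : ‖stdVec N i‖ = 1 := by simp [stdVec]

/-- `H¹` regularity and the estimate of the derivatives. -/
theorem exists_partial_of_graph {N q : ℕ} {ε : Transformation N q} {c K : ℝ}
    (hM : IsLipschitzCoeff ε.field c K) {E : Space N → Form N q} {G : Space N → Form N (q + 1)}
    {F : Space N → Form N (q - 1)} (hG : HasWeakExtDeriv E G) (hF : HasWeakCoDeriv (ε.app E) F)
    (i : Fin N) : ∃ P, HasWeakPartial i E P ∧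
      l2n (vec P) ≤ c⁻¹ * (K * l2n (vec E) + K * l2n (vec G) + l2n (vec F)) := by
  obtain ⟨hE2, hG2, hd⟩ := hasWeakExtDeriv_iff.1 hG
  obtain ⟨-, hF2, hd'⟩ := hasWeakCoDeriv_iff.1 hF
  rw [vec_app] at hd'
  obtain ⟨p, hp, hpw, hpn⟩ := exists_weakDeriv_of_hodge (isHodgePair_wedge_co N q) hM hE2 hG2 hF2
    hd hd' (stdVec N i)
  rw [norm_stdVec, mul_one] at hpn
  refine ⟨fun x => toVec.symm (p x), hasWeakPartial_iff.2 ?_, ?_⟩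
  · rw [vec_symm]; exact ⟨hE2, hp, hpw⟩
  · rwa [vec_symm]

/-- `H¹` forms have an exterior derivative and a co-derivative. -/
theorem exists_graph_of_partial {N q : ℕ} {ε : Transformation N q} {c K : ℝ}
    (hM : IsLipschitzCoeff ε.field c K) (h1 : ContDiff ℝ 1 ε.field)
    (hK : ∀ x, ‖fderiv ℝ ε.field x‖ ≤ K) {E : Space N → Form N q}
    {P : Fin N → Space N → Form N q} (hE : MemLp (vec E) 2 volume)
    (hP : ∀ i, HasWeakPartial i E (P i)) :
    ∃ G F, HasWeakExtDeriv E G ∧ HasWeakCoDeriv (ε.app E) F ∧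
      l2n (vec G) ≤ ∑ i, ‖(wedgeVec i : Comp N q →L[ℂ] Comp N (q + 1))‖ * l2n (vec (P i)) ∧
      l2n (vec F) ≤ ∑ i, ‖(coVec i : Comp N q →L[ℂ] Comp N (q - 1))‖
        * (K * l2n (vec E) + K * l2n (vec (P i))) := by
  have hP' := fun i => (hasWeakPartial_iff.1 (hP i)).2
  have hb' : ∀ i x, ‖fderiv ℝ ε.field x (stdVec N i)‖ ≤ K := fun i x =>
    ((fderiv ℝ ε.field x).le_opNorm _).trans (by rw [norm_stdVec, mul_one]; exact hK x)
  have hpr := fun i => l2_product h1 hM.nonneg hM.bound (stdVec N i) (hb' i) hE (hP' i).1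
  have hME := (l2n_coeff_apply hM.cont hM.nonneg hM.bound hE).1
  obtain ⟨g1, g2⟩ := l2n_sum_clm (fun i => (wedgeVec i : Comp N q →L[ℂ] Comp N (q + 1)))
    (fun i => (hP' i).1)
  obtain ⟨f1, f2⟩ := l2n_sum_clm (fun i => (coVec i : Comp N q →L[ℂ] Comp N (q - 1)))
    (fun i => (hpr i).1)
  refine ⟨fun x => toVec.symm (∑ i, wedgeVec i (vec (P i) x)), fun x => toVec.symm (∑ i, coVec i
    (fderiv ℝ ε.field x (stdVec N i) (vec E x) + ε.field x (vec (P i) x))), ?_, ?_, ?_, ?_⟩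
  · rw [hasWeakExtDeriv_iff, vec_symm]
    exact ⟨hE, g1, HasWeakDiv.sum_clm (fun i => (hP' i).2) hE (fun i => (hP' i).1) _⟩
  · rw [hasWeakCoDeriv_iff, vec_symm, vec_app]
    exact ⟨hME, f1, HasWeakDiv.sum_clm (fun i => HasWeakDiv.product h1 hM.nonneg hM.bound (hb' i) hE
      (hP' i).1 (hP' i).2) hME (fun i => (hpr i).1) _⟩
  · rwa [vec_symm]
  · rw [vec_symm]
    exact f2.trans (Finset.sum_le_sum fun i _ =>
      mul_le_mul_of_nonneg_left (hpr i).2 (norm_nonneg _))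

theorem h1Norm_le {e g f a K : ℝ} {n : ℕ} {p : Fin n → ℝ} (hp0 : ∀ i, 0 ≤ p i)
    (hp : ∀ i, p i ≤ a * (K * e + K * g + f)) :
    √(e ^ 2 + ∑ i, p i ^ 2) ≤ √(1 + n * (a ^ 2 * (3 * (K ^ 2 + 1)))) * √(e ^ 2 + g ^ 2 + f ^ 2) := by
  rw [← Real.sqrt_mul (by positivity)]
  refine Real.sqrt_le_sqrt ?_
  have h1 : ∀ i, p i ^ 2 ≤ a ^ 2 * (3 * (K ^ 2 + 1)) * (e ^ 2 + g ^ 2 + f ^ 2) := fun i => by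
    refine (pow_le_pow_left₀ (hp0 i) (hp i) 2).trans ?_
    rw [mul_pow, mul_assoc]
    refine mul_le_mul_of_nonneg_left ?_ (sq_nonneg a)
    -- The constant comes from $(x+y+z)^2\le 3(x^2+y^2+z^2)$ and $\max(K^2,1)\le K^2+1$.
    nlinarith [sq_nonneg (K * e - K * g), sq_nonneg (K * e - f), sq_nonneg (K * g - f),
      sq_nonneg e, sq_nonneg g, sq_nonneg (K * f)]
  have h2 : ∑ i, p i ^ 2 ≤ n * (a ^ 2 * (3 * (K ^ 2 + 1)) * (e ^ 2 + g ^ 2 + f ^ 2)) := by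
    refine (Finset.sum_le_sum fun i _ => h1 i).trans ?_
    simp
  nlinarith [sq_nonneg g, sq_nonneg f]

theorem graphNorm_le {e g f K : ℝ} {n : ℕ} {p A B : Fin n → ℝ} (he : 0 ≤ e) (hg0 : 0 ≤ g)
    (hf0 : 0 ≤ f) (hK : 0 ≤ K) (hA : ∀ i, 0 ≤ A i) (hB : ∀ i, 0 ≤ B i)
    (hg : g ≤ ∑ i, A i * p i) (hf : f ≤ ∑ i, B i * (K * e + K * p i)) :
    √(e ^ 2 + g ^ 2 + f ^ 2) ≤ (1 + ∑ i, A i + ∑ i, B i * (2 * K)) * √(e ^ 2 + ∑ i, p i ^ 2) := by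
  set s := √(e ^ 2 + ∑ i, p i ^ 2) with hs
  have hsum : 0 ≤ ∑ i, p i ^ 2 := Finset.sum_nonneg fun i _ => sq_nonneg _
  have hs0 : 0 ≤ s := Real.sqrt_nonneg _
  have hes : e ≤ s := Real.le_sqrt_of_sq_le (by linarith)
  have hps : ∀ i, p i ≤ s := fun i => Real.le_sqrt_of_sq_le (by
    have := Finset.single_le_sum (f := fun i => p i ^ 2) (fun i _ => sq_nonneg _) (Finset.mem_univ i)
    nlinarith [sq_nonneg e])
  have hgs : g ≤ (∑ i, A i) * s := by
    refine hg.trans ?_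
    rw [Finset.sum_mul]
    exact Finset.sum_le_sum fun i _ => mul_le_mul_of_nonneg_left (hps i) (hA i)
  have hfs : f ≤ (∑ i, B i * (2 * K)) * s := by
    refine hf.trans ?_
    rw [Finset.sum_mul]
    refine Finset.sum_le_sum fun i _ => ?_
    rw [mul_assoc]
    refine mul_le_mul_of_nonneg_left ?_ (hB i)
    nlinarith [mul_le_mul_of_nonneg_left hes hK, mul_le_mul_of_nonneg_left (hps i) hK]
  rw [Real.sqrt_le_left (by
    have h1 : 0 ≤ ∑ i, A i := Finset.sum_nonneg fun i _ => hA i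
    have h2 : 0 ≤ ∑ i, B i * (2 * K) :=
      Finset.sum_nonneg fun i _ => mul_nonneg (hB i) (by positivity)
    positivity)]
  -- The Euclidean norm of three nonnegative numbers is at most their sum, and each of them is a
  -- multiple of `s`.
  have : e + g + f ≤ (1 + ∑ i, A i + ∑ i, B i * (2 * K)) * s := by linarith
  refine le_trans ?_ (pow_le_pow_left₀ (by positivity) this 2)
  nlinarith [mul_nonneg he hg0, mul_nonneg he hf0, mul_nonneg hg0 hf0]

end FormRegularity
end

theorem lemma4p3 (N q : ℕ) (ε : FormRegularity.Transformation N q)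
    (hε : FormRegularity.IsCmAdmissible 1 ε) :
    FormRegularity.DSpace N q ∩ ε.app ⁻¹' FormRegularity.DeltaSpace N q
        = FormRegularity.H1Space N q ∧
      ∃ c : ℝ, 0 < c ∧
        ∀ (E : FormRegularity.Space N → FormRegularity.Form N q) (G : FormRegularity.Space N → FormRegularity.Form N (q + 1))
          (F : FormRegularity.Space N → FormRegularity.Form N (q - 1)) (P : Fin N → FormRegularity.Space N → FormRegularity.Form N q),
          FormRegularity.HasWeakExtDeriv E G →
          FormRegularity.HasWeakCoDeriv (ε.app E) F →
          (∀ i, FormRegularity.HasWeakPartial i E (P i)) →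
            FormRegularity.h1Norm E P ≤ c * FormRegularity.graphNorm E G F ∧
            FormRegularity.graphNorm E G F ≤ c * FormRegularity.h1Norm E P := by
  open FormRegularity in
  obtain ⟨h1, c, K, hK, hM⟩ := hε.exists_field_bound
  refine ⟨Set.ext fun E => ⟨fun ⟨⟨hE, G, hG⟩, _, F, hF⟩ => ⟨hE, fun i => ?_⟩, fun ⟨hE, hP⟩ => ?_⟩, ?_⟩
  · obtain ⟨P, hP, -⟩ := exists_partial_of_graph hM hG hF i
    exact ⟨P, hP⟩
  · choose P hP using hP
    obtain ⟨G, F, hG, hF, -⟩ := exists_graph_of_partial hM h1 hK (isL2_iff.1 hE) hP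
    refine ⟨⟨hE, G, hG⟩, isL2_iff.2 (hasWeakCoDeriv_iff.1 hF).1, F, hF⟩
  · set A : Fin N → ℝ := fun i => ‖(wedgeVec i : Comp N q →L[ℂ] Comp N (q + 1))‖
    set B : Fin N → ℝ := fun i => ‖(coVec i : Comp N q →L[ℂ] Comp N (q - 1))‖
    set c₁ := √(1 + N * (c⁻¹ ^ 2 * (3 * (K ^ 2 + 1))))
    set c₂ := 1 + ∑ i, A i + ∑ i, B i * (2 * K)
    -- The entry $1$ only secures positivity; `c₁` and `c₂` are built from the data of $\varepsilon$
    -- and the fixed symbols, not from `E`.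
    refine ⟨max 1 (max c₁ c₂), lt_max_of_lt_left one_pos, fun E G F P hG hF hP => ?_⟩
    obtain ⟨hE2, hG2, hGw⟩ := hasWeakExtDeriv_iff.1 hG
    obtain ⟨-, hF2, hFw⟩ := hasWeakCoDeriv_iff.1 hF
    have hP2 := fun i => (hasWeakPartial_iff.1 (hP i)).2
    have e1 : h1Norm E P = √(l2n (vec E) ^ 2 + ∑ i, l2n (vec (P i)) ^ 2) := by
      rw [h1Norm, l2NormSq_eq hE2]
      simp_rw [fun i => l2NormSq_eq (hP2 i).1]
    have e2 : graphNorm E G F = √(l2n (vec E) ^ 2 + l2n (vec G) ^ 2 + l2n (vec F) ^ 2) := by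
      rw [graphNorm, l2NormSq_eq hE2, l2NormSq_eq hG2, l2NormSq_eq hF2]
    constructor
    · have hp : ∀ i, l2n (vec (P i))
          ≤ c⁻¹ * (K * l2n (vec E) + K * l2n (vec G) + l2n (vec F)) := fun i => by
        obtain ⟨P', hP', hn⟩ := exists_partial_of_graph hM hG hF i
        have h3 := (hasWeakPartial_iff.1 hP').2
        -- The estimate is proved for the constructed derivative `P'`; uniqueness transfers it to
        -- the given `P i`.
        rwa [l2n_congr_ae ((hP2 i).2.ae_unique (hP2 i).1 h3.1 h3.2)]
      rw [e2, e1]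
      refine (h1Norm_le (fun i => l2n_nonneg _) hp).trans ?_
      exact mul_le_mul_of_nonneg_right ((le_max_left _ _).trans (le_max_right _ _))
        (Real.sqrt_nonneg _)
    · obtain ⟨G', F', hG', hF', hg, hf⟩ := exists_graph_of_partial hM h1 hK hE2 hP
      have hG3 := (hasWeakExtDeriv_iff.1 hG').2
      have hF3 := (hasWeakCoDeriv_iff.1 hF').2
      rw [← l2n_congr_ae (hGw.ae_unique hG2 hG3.1 hG3.2)] at hg
      rw [← l2n_congr_ae (hFw.ae_unique hF2 hF3.1 hF3.2)] at hf
      rw [e2, e1]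
      refine (graphNorm_le (l2n_nonneg _) (l2n_nonneg _) (l2n_nonneg _) hM.nonneg
        (fun i => norm_nonneg _) (fun i => norm_nonneg _) hg hf).trans ?_
      exact mul_le_mul_of_nonneg_right ((le_max_right _ _).trans (le_max_right _ _))
        (Real.sqrt_nonneg _)
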